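/- Let $d \ge 0$ and $A = \mathbb{Z}[x_1,\dots,x_d]/\mathfrak{m}^2$, where $\mathfrak{m} = (x_1,\dots,x_d)$. On $A^{\otimes (q+1)}$ (tensor powers over $\mathbb{Z}$) let $b$ be the Hochschild differential, $b'$ the bar differential (the Hochschild differential without its last, cyclic, face), $t_q(a_0\otimes\cdots\otimes a_q) = (-1)^q\, a_q\otimes a_0\otimes\cdots\otimes a_{q-1}$ and $N_q = 1 + t_q + \cdots + t_q^q$. Consider the second quadrant double complex with $A^{\otimes(q+1)}$ in column $p \le 0$ and row $q \ge 0$, vertical differential $b$ in the even columns and $b'$ in the odd ones, and horizontal differential $N_q$ out of the even columns and $1 - t_q$ out of the odd ones. The negative cyclic homology of $A$ is the homology of its (direct product) total complex, whose differential is the horizontal one plus $(-1)^p$ times the vertical one. The weight of a tensor monomial is the total number of variables $x_i$ in it. The double complex splits by weight, and $(HC^-)^{(w)}_n(A)$ denotes the $n$-th homology of the total complex of its weight $w$ part. The cycle length of a word in $x_1,\dots,x_d$ is the smallest positive number of cyclic rotations by one letter that leaves it unchanged, and its cycle family is the set of all its rotations. Let $\omega_{m,d}$ be the set of cycle families of the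 words of length $m$ and cycle length $m$ in $x_1,\dots,x_d$. Then, for $n \in \mathbb{Z}$, $$(HC^-)^{(0)}_n(A) \cong \begin{cases} \mathbb{Z} & n \text{ even and } n \le 0,\\ 0 & \text{otherwise,}\end{cases}$$ and for every integer $w > 0$ $$(HC^-)^{(w)}_n(A) \cong \begin{cases} 0 & n > w,\\[2pt] \displaystyle\bigoplus_{\substack{m \mid w\\ m \equiv w \ (\mathrm{mod}\ 2)}}\ \bigoplus_{\omega_{m,d}} \mathbb{Z} & n = w,\\[2pt] \displaystyle\bigoplus_{\substack{m \mid w\\ m \not\equiv w \ (\mathrm{mod}\ 2)}}\ \bigoplus_{\omega_{m,d}} \mathbb{Z}/2 & n = w - 1 - 2i,\ i \ge 0,\\[2pt] \displaystyle\bigoplus_{\substack{m \mid w\\ m \equiv w \ (\mathrm{mod}\ 2)}}\ \bigoplus_{\omega_{m,d}} \mathbb{Z}/(w/m) & n = w - 2i,\ i > 0.\end{cases}$$ Moreover, for every $m \ge 1$ the set $\omega_{m,d}$ is finite, of order $\frac1m \sum_{i \mid m} \mu(m/i)\, d^i$, where $\mu$ is the Möbius function. -/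

import Mathlib

open scoped DirectSum

noncomputable section

namespace NegCyc

section Hochschild

variable (k : Type) [CommRing k] (A : Type) [Ring A] [Algebra k A]

/-- `A^{⊗ (n+1)}`, the module in degree `n` of the Hochschild complex and of the bar complex. -/
abbrev Chain (n : ℕ) : Type := PiTensorProduct k (fun _ : Fin (n + 1) => A)

theorem contractNth_update {n : ℕ} (i : Fin (n + 1)) (m : Fin (n + 2)) (a : Fin (n + 2) → A) :
    ∃ (j : Fin (n + 1)) (F : A →ₗ[k] A), ∀ x : A,
      Fin.contractNth i.castSucc (· * ·) (Function.update a m x) =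
        Function.update (Fin.contractNth i.castSucc (· * ·) a) j (F x) := by
  rcases lt_trichotomy (m : ℕ) i with h | h | h
  · refine ⟨⟨m, by omega⟩, LinearMap.id, fun x => ?_⟩
    ext l
    simp only [Fin.contractNth, Function.update_apply, Fin.ext_iff, Fin.val_castSucc,
      Fin.val_succ, LinearMap.id_coe, id_eq]
    split_ifs <;> first | rfl | omega
  · refine ⟨⟨m, by omega⟩, LinearMap.mulRight k (a i.succ), fun x => ?_⟩
    ext l
    simp only [Fin.contractNth, Function.update_apply, Fin.ext_iff, Fin.val_castSucc,
      Fin.val_succ, LinearMap.mulRight_apply]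
    split_ifs with h1 h2 h3 h4 h5 h6 <;>
      first
        | rfl
        | omega
        | (have : l = i := Fin.ext (by omega)
           subst this; rfl)
  · by_cases h' : (m : ℕ) = i + 1
    · refine ⟨i, LinearMap.mulLeft k (a i.castSucc), fun x => ?_⟩
      ext l
      simp only [Fin.contractNth, Function.update_apply, Fin.ext_iff, Fin.val_castSucc,
        Fin.val_succ, LinearMap.mulLeft_apply]
      split_ifs with h1 h2 h3 h4 h5 h6 <;>
        first
          | rfl
          | omega
          | (have : l = i := Fin.ext (by omega)
             subst this; rfl)
    · refine ⟨⟨m - 1, by omega⟩, LinearMap.id, fun x => ?_⟩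
      ext l
      simp only [Fin.contractNth, Function.update_apply, Fin.ext_iff, Fin.val_castSucc,
        Fin.val_succ, LinearMap.id_coe, id_eq]
      split_ifs <;> first | rfl | omega

/-- The face `d_i (a_0 ⊗ ⋯ ⊗ a_{n+1}) = a_0 ⊗ ⋯ ⊗ a_i a_{i+1} ⊗ ⋯ ⊗ a_{n+1}`, for `0 ≤ i ≤ n`. -/
def face (n : ℕ) (i : Fin (n + 1)) : Chain k A (n + 1) →ₗ[k] Chain k A n :=
  PiTensorProduct.lift
    { toFun := fun a =>
        PiTensorProduct.tprod k (Fin.contractNth (α := A) i.castSucc (· * ·) a)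
      map_update_add' := by
        intro inst a m x y
        obtain rfl : inst = instDecidableEqFin (n + 1 + 1) := Subsingleton.elim _ _
        obtain ⟨j, F, hF⟩ := contractNth_update k A i m a
        simp only [hF, map_add, MultilinearMap.map_update_add]
      map_update_smul' := by
        intro inst a m c x
        obtain rfl : inst = instDecidableEqFin (n + 1 + 1) := Subsingleton.elim _ _
        obtain ⟨j, F, hF⟩ := contractNth_update k A i m a
        simp only [hF, map_smul, MultilinearMap.map_update_smul] }

/-- The unsigned rotation `a_0 ⊗ ⋯ ⊗ a_n ↦ a_n ⊗ a_0 ⊗ ⋯ ⊗ a_{n-1}`. -/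
def rot (n : ℕ) : Chain k A n →ₗ[k] Chain k A n :=
  (PiTensorProduct.reindex k (fun _ : Fin (n + 1) => A) (finRotate (n + 1))).toLinearMap

/-- The signed rotation `t_n (a_0 ⊗ ⋯ ⊗ a_n) = (-1)^n (a_n ⊗ a_0 ⊗ ⋯ ⊗ a_{n-1})`. -/
def t (n : ℕ) : Chain k A n →ₗ[k] Chain k A n := (-1 : k) ^ n • rot k A n

/-- The norm `N_n = 1 + t_n + ⋯ + t_n^n`. -/
def N (n : ℕ) : Chain k A n →ₗ[k] Chain k A n := ∑ i ∈ Finset.range (n + 1), t k A n ^ i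

/-- The last face `d_{n+1} (a_0 ⊗ ⋯ ⊗ a_{n+1}) = a_{n+1} a_0 ⊗ a_1 ⊗ ⋯ ⊗ a_n`. -/
def lastFace (n : ℕ) : Chain k A (n + 1) →ₗ[k] Chain k A n := face k A n 0 ∘ₗ rot k A (n + 1)

/-- The bar differential `b'_{n+1} = ∑_{i=0}^{n} (-1)^i d_i : A^{⊗ (n+2)} → A^{⊗ (n+1)}`. -/
def b' (n : ℕ) : Chain k A (n + 1) →ₗ[k] Chain k A n :=
  ∑ i : Fin (n + 1), (-1 : k) ^ (i : ℕ) • face k A n i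

/-- The Hochschild differential
`b_{n+1} = ∑_{i=0}^{n+1} (-1)^i d_i : A^{⊗ (n+2)} → A^{⊗ (n+1)}`. -/
def b (n : ℕ) : Chain k A (n + 1) →ₗ[k] Chain k A n :=
  b' k A n + (-1 : k) ^ (n + 1) • lastFace k A n

/-- The vertical differential, from row `q + 1` to row `q`, in the column numbered `-j` of the
second quadrant double complex: `b` in the even columns, `b'` in the odd ones. -/
def vert (j q : ℕ) : Chain k A (q + 1) →ₗ[k] Chain k A q :=
  if Even j then b k A q else b' k A q

/-- The horizontal differential, in row `q`, from the column numbered `-j` to the column numbered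
`-(j + 1)`: `N` out of the even columns, `1 - t` out of the odd ones. -/
def horiz (j q : ℕ) : Chain k A q →ₗ[k] Chain k A q :=
  if Even j then N k A q else LinearMap.id - t k A q

/-- Degree `n` of the (direct product) total complex of the second quadrant double complex: the
product over all positions (column `-j ≤ 0`, row `q ≥ 0`) with `q - j = n`. -/
abbrev Tot (n : ℤ) : Type :=
  (p : {p : ℕ × ℕ // (p.2 : ℤ) - (p.1 : ℤ) = n}) → Chain k A p.1.2

/-- The total differential from degree `n` to degree `m = n - 1`.  Its component at
(column `-j`, row `q`) is `(-1)^j` times the vertical differential from (column `-j`, row `q + 1`)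
plus, if `j > 0`, the horizontal differential from (column `-(j - 1)`, row `q`). -/
def totD (n m : ℤ) (h : m + 1 = n) : Tot k A n →ₗ[k] Tot k A m :=
  LinearMap.pi fun p =>
    match p with
    | ⟨(0, q), hp⟩ =>
        vert k A 0 q ∘ₗ
          LinearMap.proj (φ := fun p : {p : ℕ × ℕ // (p.2 : ℤ) - (p.1 : ℤ) = n} => Chain k A p.1.2)
            ⟨(0, q + 1), by push_cast at hp ⊢; omega⟩
    | ⟨(j + 1, q), hp⟩ =>
        (-1 : k) ^ (j + 1) • (vert k A (j + 1) q ∘ₗ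
          LinearMap.proj (φ := fun p : {p : ℕ × ℕ // (p.2 : ℤ) - (p.1 : ℤ) = n} => Chain k A p.1.2)
            ⟨(j + 1, q + 1), by push_cast at hp ⊢; omega⟩) +
        horiz k A j q ∘ₗ
          LinearMap.proj (φ := fun p : {p : ℕ × ℕ // (p.2 : ℤ) - (p.1 : ℤ) = n} => Chain k A p.1.2)
            ⟨(j, q), by push_cast at hp ⊢; omega⟩

end Hochschild

/-- The ring `ℤ[x_1, …, x_d] / (x_1, …, x_d)^2`. -/
abbrev SqZero (d : ℕ) : Type :=
  MvPolynomial (Fin d) ℤ ⧸ (Ideal.span (Set.range (MvPolynomial.X (R := ℤ) (σ := Fin d)))) ^ 2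

/-- The nonzero monomials of `ℤ[x_1, …, x_d] / (x_1, …, x_d)^2`: the unit and the classes of the
variables. -/
def mono (d : ℕ) : Option (Fin d) → SqZero d
  | none => 1
  | some i => Ideal.Quotient.mk _ (MvPolynomial.X i)

/-- The number of tensor factors of a tensor monomial that are variables. -/
def weight {d n : ℕ} (f : Fin (n + 1) → Option (Fin d)) : ℕ :=
  (Finset.univ.filter fun i => (f i).isSome).card

/-- The weight `w` part of `A^{⊗ (n+1)}`, for `A = ℤ[x_1, …, x_d] / (x_1, …, x_d)^2`: the span of
the tensor monomials of weight `w`. -/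
def weightPart (d w n : ℕ) : Submodule ℤ (Chain ℤ (SqZero d) n) :=
  Submodule.span ℤ {z | ∃ f : Fin (n + 1) → Option (Fin d), weight f = w ∧
    z = PiTensorProduct.tprod ℤ fun i => mono d (f i)}

/-- Degree `n` of the weight `w` subcomplex of the total complex. -/
def totWeight (d w : ℕ) (n : ℤ) : Submodule ℤ (Tot ℤ (SqZero d) n) :=
  Submodule.pi Set.univ fun p => weightPart d w p.1.2

/-- The cycles of degree `n` in the weight `w` subcomplex. -/
def cycles (d w : ℕ) (n : ℤ) : Submodule ℤ (Tot ℤ (SqZero d) n) :=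
  totWeight d w n ⊓ LinearMap.ker (totD ℤ (SqZero d) n (n - 1) (by omega))

/-- The boundaries of degree `n` in the weight `w` subcomplex. -/
def boundaries (d w : ℕ) (n : ℤ) : Submodule ℤ (Tot ℤ (SqZero d) n) :=
  (totWeight d w (n + 1)).map (totD ℤ (SqZero d) (n + 1) n rfl)

/-- `(HC^-)^{(w)}_n` of `ℤ[x_1, …, x_d] / (x_1, …, x_d)^2`: the weight `w` part of negative cyclic
homology in degree `n`. -/
abbrev HCneg (d w : ℕ) (n : ℤ) : Type :=
  cycles d w n ⧸ (boundaries d w n).submoduleOf (cycles d w n)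

/-- The rotation of a word of length `m` that moves the last letter to the front. -/
def rotWord {m d : ℕ} (v : Fin m → Fin d) : Fin m → Fin d := fun i => v ((finRotate m).symm i)

/-- The smallest positive number of rotations that leaves the word unchanged. -/
def cycleLength {m d : ℕ} (v : Fin m → Fin d) : ℕ := Function.minimalPeriod rotWord v

/-- The set of all rotations of a word. -/
def cycleFamily {m d : ℕ} (v : Fin m → Fin d) : Set (Fin m → Fin d) :=
  {u | ∃ n : ℕ, u = rotWord^[n] v}

/-- `ω_{m,d}`: the cycle families of the words of length `m` and cycle length `m` in `d` letters. -/
def omega (m d : ℕ) : Set (Set (Fin m → Fin d)) :=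
  {S | ∃ v : Fin m → Fin d, cycleLength v = m ∧ S = cycleFamily v}

end NegCyc

end

/-! The unit and the variables form a basis of `A` over `ℤ`, so the tensor monomials form a basis of
each tensor power. The double complex is therefore a complex of words in letters and units, where a
unit is absorbed by its neighbour and a product of two letters is zero.

The odd columns (bar) are contracted by prepending a unit. The even columns (Hochschild) are
contracted, by doubling the first unit away from the head, onto the words without units (`projQ`)
and the words whose only unit is at the head (`projP`); this is `hoch_homotopy`. In weight `w > 0`
both are copies of the group `L` spanned by the words of `w` letters. They sit in degrees `w - 1 -
2k` and `w - 2k` for the column `-2k`, and what remains of the total complex is `L → L → L → ⋯`,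
starting in degree `w`, with maps alternately `1 - t` and `N`. Hence the homology is `ker (1 - t)`
in degree `w`, `ker N / im (1 - t)` in the degrees `w - 1 - 2k`, and `ker (1 - t) / im N` in the
degrees `w - 2(k + 1)`. In weight zero the word without units would be empty and is absent, so only
one `ℤ` in each degree `-2k` is left.

The reduction is carried by explicit projections `reduceEven` and `reduceOdd`, compatible with the
differentials. A cycle on which they vanish is a boundary (`exists_totDW_eq`). Its primitive is
built column by column and may meet infinitely many columns, which the direct product total complex
allows.

Finally `L` splits over the orbits of rotation on words, an orbit of length `m` being a cycle family
of primitive words of length `m` with `m ∣ w`. On it `t ^ m` is the sign `(-1) ^ ((w - 1) * m)`,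
which is `1` exactly when `m ≡ w` modulo 2. For sign `1` the invariants are `ℤ`, the norm is `w / m`
times the orbit sum, and `ker N = im (1 - t)`. For sign `-1` there are no invariants, the norm is
zero, and the image of `1 - t` consists of the functions with even alternating orbit sum. The count
of the cycle families is Möbius inversion of `∑ m * |ω_m| = d ^ w`. -/

noncomputable section

namespace NegCyc

/-! ### Words in letters and units: the bar, Hochschild and cyclic operators -/

section Words

variable {α : Type}

/-- The free abelian group on the words in the letters `α` and the unit `none`. -/
abbrev Words (α : Type) : Type := List (Option α) →₀ ℤ

/-- A word as an element of the free abelian group. -/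
def word (l : List (Option α)) : Words α := Finsupp.single l 1

/-- The linear extension of a function on words. -/
def extend (g : List (Option α) → Words α) : Words α →ₗ[ℤ] Words α :=
  Finsupp.linearCombination ℤ g

@[simp] theorem extend_word (g : List (Option α) → Words α) (l : List (Option α)) :
    extend g (word l) = g l := by
  simp [extend, word]

theorem words_hom_ext {M : Type*} [AddCommGroup M] {f g : Words α →ₗ[ℤ] M}
    (h : ∀ l, f (word l) = g (word l)) : f = g :=
  Finsupp.lhom_ext' fun l => LinearMap.ext_ring (h l)

/-- Prepend a letter. -/
def consW (a : Option α) : Words α →ₗ[ℤ] Words α := extend fun l => word (a :: l)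

/-- Append a letter. -/
def snocW (a : Option α) : Words α →ₗ[ℤ] Words α := extend fun l => word (l ++ [a])

@[simp] theorem consW_word (a : Option α) (l) : consW a (word l) = word (a :: l) := extend_word _ _

@[simp] theorem snocW_word (a : Option α) (l) : snocW a (word l) = word (l ++ [a]) :=
  extend_word _ _

theorem consW_snocW (a z : Option α) (e : Words α) :
    consW a (snocW z e) = snocW z (consW a e) :=
  LinearMap.congr_fun (words_hom_ext (f := consW a ∘ₗ snocW z) (g := snocW z ∘ₗ consW a)
    fun l => by simp) e

/-- Multiply the first two letters of a word. -/
def mulHeadFun : List (Option α) → Words α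
  | none :: c :: l => word (c :: l)
  | some x :: none :: l => word (some x :: l)
  | some _ :: some _ :: _ => 0
  | [_] => 0
  | [] => 0

/-- The linear extension of multiplication of the first two letters. -/
def mulHead : Words α →ₗ[ℤ] Words α := extend mulHeadFun

@[simp] theorem mulHead_nil : mulHead (word ([] : List (Option α))) = 0 := extend_word _ _
@[simp] theorem mulHead_single (a : Option α) : mulHead (word [a]) = 0 := by
  cases a <;> exact extend_word _ _
@[simp] theorem mulHead_none (c : Option α) (l) :
    mulHead (word (none :: c :: l)) = word (c :: l) := extend_word _ _
@[simp] theorem mulHead_some_none (x : α) (l) :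
    mulHead (word (some x :: none :: l)) = word (some x :: l) := extend_word _ _
@[simp] theorem mulHead_some_some (x y : α) (l) :
    mulHead (word (some x :: some y :: l)) = 0 := extend_word _ _

/-- The bar differential of a word. -/
def barFun : List (Option α) → Words α
  | [] => 0
  | [_] => 0
  | a :: c :: l => mulHeadFun (a :: c :: l) - consW a (barFun (c :: l))

/-- The bar differential on words. -/
def bar : Words α →ₗ[ℤ] Words α := extend barFun

@[simp] theorem bar_nil : bar (word ([] : List (Option α))) = 0 := extend_word _ _
@[simp] theorem bar_single (a : Option α) : bar (word [a]) = 0 := extend_word _ _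
theorem bar_cons_cons (a c : Option α) (l) :
    bar (word (a :: c :: l)) = mulHead (word (a :: c :: l)) - consW a (bar (word (c :: l))) := by
  rw [bar, mulHead, extend_word, extend_word, extend_word]; rfl

/-- The rotation of a list which moves the last entry to the front. -/
def rotList {β : Type} (l : List β) : List β := l.rotate (l.length - 1)

@[simp] theorem rotList_nil {β : Type} : rotList ([] : List β) = [] := rfl
@[simp] theorem rotList_concat {β : Type} (l : List β) (z : β) : rotList (l ++ [z]) = z :: l := by
  simp [rotList]
@[simp] theorem length_rotList {β : Type} (l : List β) : (rotList l).length = l.length := by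
  simp [rotList]

/-- The signed rotation on words. -/
def tW : Words α →ₗ[ℤ] Words α :=
  extend fun l => (-1 : ℤ) ^ (l.length - 1) • word (rotList l)

@[simp] theorem tW_nil : tW (word ([] : List (Option α))) = word [] := by simp [tW]
@[simp] theorem tW_concat (l : List (Option α)) (z) :
    tW (word (l ++ [z])) = (-1 : ℤ) ^ l.length • word (z :: l) := by simp [tW]

/-- Each of the `v.length` rotations moves one letter past all the others and contributes the same
sign. -/
theorem tW_pow_append (u v : List (Option α)) :
    (tW ^ v.length) (word (u ++ v)) =
      (-1 : ℤ) ^ ((u.length + v.length - 1) * v.length) • word (v ++ u) := by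
  induction v using List.reverseRecOn generalizing u with
  | nil => simp
  | append_singleton v z ih =>
    rw [List.length_append, List.length_singleton, pow_succ, Module.End.mul_apply,
      ← List.append_assoc, tW_concat, map_smul, ← List.cons_append, ih, smul_smul, ← pow_add]
    congr 2
    · simp only [List.length_append, List.length_cons]
      rw [show u.length + 1 + v.length - 1 = u.length + v.length by omega,
        show u.length + (v.length + 1) - 1 = u.length + v.length by omega]
      ring
    · simp

theorem tW_pow_length (l : List (Option α)) : (tW ^ l.length) (word l) = word l := by
  have := tW_pow_append [] l
  simp only [List.nil_append, List.length_nil, zero_add, List.append_nil] at this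
  rw [this, Even.neg_one_pow, one_smul]
  rw [mul_comm]; exact Nat.even_mul_pred_self _

/-- The norm on words. -/
def NW : Words α →ₗ[ℤ] Words α :=
  extend fun l => ∑ i ∈ Finset.range l.length, (tW ^ i) (word l)

theorem NW_word (l : List (Option α)) :
    NW (word l) = ∑ i ∈ Finset.range l.length, (tW ^ i) (word l) := extend_word _ _

/-- The Hochschild differential on words. -/
def hoch : Words α →ₗ[ℤ] Words α := bar + mulHead ∘ₗ tW

/-- The span of the words with a given property. -/
def wordsIn (p : List (Option α) → Prop) : Submodule ℤ (Words α) :=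
  Submodule.span ℤ {e | ∃ l : List (Option α), p l ∧ e = word l}

theorem word_mem_wordsIn {p : List (Option α) → Prop} {l : List (Option α)} (h : p l) :
    word l ∈ wordsIn p :=
  Submodule.subset_span ⟨l, h, rfl⟩

theorem eqOn_wordsIn {M : Type*} [AddCommGroup M] {p : List (Option α) → Prop}
    {f g : Words α →ₗ[ℤ] M} (h : ∀ l, p l → f (word l) = g (word l)) {e : Words α}
    (he : e ∈ wordsIn p) : f e = g e := by
  refine LinearMap.eqOn_span (R := ℤ) ?_ he
  rintro _ ⟨l, hl, rfl⟩
  exact h l hl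

theorem map_mem_of_wordsIn {M : Type*} [AddCommGroup M] {p : List (Option α) → Prop}
    {f : Words α →ₗ[ℤ] M} {S : Submodule ℤ M}
    (h : ∀ l, p l → f (word l) ∈ S) {e : Words α} (he : e ∈ wordsIn p) : f e ∈ S := by
  have : wordsIn p ≤ S.comap f := by
    refine Submodule.span_le.2 ?_
    rintro _ ⟨l, hl, rfl⟩
    exact h l hl
  exact this he

/-- The span of the words of a given length. -/
abbrev ofLength (α : Type) (n : ℕ) : Submodule ℤ (Words α) := wordsIn fun l => l.length = n

theorem tW_mem_ofLength {n : ℕ} {e : Words α} (he : e ∈ ofLength α n) :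
    tW e ∈ ofLength α n := by
  refine map_mem_of_wordsIn (fun l hl => ?_) he
  rw [tW, extend_word]
  exact Submodule.smul_mem _ _ (word_mem_wordsIn (by simpa using hl))

theorem consW_mem_ofLength {n : ℕ} (a) {e : Words α} (he : e ∈ ofLength α n) :
    consW a e ∈ ofLength α (n + 1) := by
  refine map_mem_of_wordsIn (fun l hl => ?_) he
  rw [consW_word]
  exact word_mem_wordsIn (by simpa using hl)

theorem mulHead_mem_ofLength {n : ℕ} {e : Words α} (he : e ∈ ofLength α (n + 1)) :
    mulHead e ∈ ofLength α n := by
  refine map_mem_of_wordsIn (fun l hl => ?_) he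
  match l, hl with
  | none :: c :: l, hl => rw [mulHead_none]; exact word_mem_wordsIn (by simpa using hl)
  | some x :: none :: l, hl => rw [mulHead_some_none]; exact word_mem_wordsIn (by simpa using hl)
  | some x :: some y :: l, hl => rw [mulHead_some_some]; exact zero_mem _
  | [a], hl => rw [mulHead_single]; exact zero_mem _

theorem bar_word_mem_ofLength : ∀ {n : ℕ} (l : List (Option α)), l.length = n + 1 →
    bar (word l) ∈ ofLength α n
  | n, [a], _ => by rw [bar_single]; exact zero_mem _
  | n, a :: c :: l, h => by
    rw [bar_cons_cons]
    refine Submodule.sub_mem _ (mulHead_mem_ofLength (word_mem_wordsIn h)) ?_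
    obtain ⟨n, rfl⟩ : ∃ k, n = k + 1 := ⟨l.length, by simpa using h.symm⟩
    exact consW_mem_ofLength a (bar_word_mem_ofLength (c :: l) (by simpa using h))

theorem bar_mem_ofLength {n : ℕ} {e : Words α} (he : e ∈ ofLength α (n + 1)) :
    bar e ∈ ofLength α n :=
  map_mem_of_wordsIn bar_word_mem_ofLength he

theorem hoch_mem_ofLength {n : ℕ} {e : Words α} (he : e ∈ ofLength α (n + 1)) :
    hoch e ∈ ofLength α n :=
  add_mem (bar_mem_ofLength he) (mulHead_mem_ofLength (tW_mem_ofLength he))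

theorem tW_snocW {n : ℕ} (z : Option α) {e : Words α} (he : e ∈ ofLength α n) :
    tW (snocW z e) = (-1 : ℤ) ^ n • consW z e := by
  refine eqOn_wordsIn (f := tW ∘ₗ snocW z) (g := ((-1 : ℤ) ^ n) • consW z) (fun l hl => ?_) he
  rw [LinearMap.comp_apply, LinearMap.smul_apply, snocW_word, tW_concat, consW_word, hl]

theorem mulHead_concat (a c z : Option α) (l) :
    mulHead (word (a :: c :: (l ++ [z]))) = snocW z (mulHead (word (a :: c :: l))) := by
  cases a <;> cases c <;> simp

/-- Prepend a list of letters. -/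
def prependW (m : List (Option α)) : Words α →ₗ[ℤ] Words α := extend fun l => word (m ++ l)

@[simp] theorem prependW_word (m l : List (Option α)) : prependW m (word l) = word (m ++ l) :=
  extend_word _ _

theorem consW_prependW (a : Option α) (m) (e : Words α) :
    consW a (prependW m e) = prependW (a :: m) e :=
  LinearMap.congr_fun (words_hom_ext (f := consW a ∘ₗ prependW m) (g := prependW (a :: m))
    fun l => by simp) e

@[simp] theorem prependW_nil (e : Words α) : prependW [] e = e :=
  LinearMap.congr_fun (words_hom_ext (f := prependW []) (g := LinearMap.id) fun l => by simp) e

theorem bar_concat_concat (l : List (Option α)) (y z) :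
    bar (word (l ++ [y, z])) = snocW z (bar (word (l ++ [y]))) +
      (-1 : ℤ) ^ l.length • prependW l (mulHead (word [y, z])) := by
  induction l with
  | nil => simp [bar_cons_cons]
  | cons a l ih =>
    cases l with
    | nil =>
      have := mulHead_concat a y z []
      simp only [List.nil_append] at this
      simp only [List.cons_append, List.nil_append, bar_cons_cons, bar_single, map_zero, sub_zero,
        this, List.length_singleton, pow_one, ← consW_prependW, prependW_nil]
      simp [sub_eq_add_neg]
    | cons c l =>
      have := mulHead_concat a c z (l ++ [y])
      simp only [List.cons_append, List.append_assoc, List.nil_append] at ih this ⊢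
      rw [bar_cons_cons, ih, bar_cons_cons, this, ← consW_prependW a]
      simp only [map_add, map_sub, map_smul, consW_snocW, List.length_cons, pow_succ]
      simp only [mul_neg, mul_one, neg_smul]
      abel

theorem bar_cons (a : Option α) (l) :
    bar (word (a :: l)) = mulHead (word (a :: l)) - consW a (bar (word l)) := by
  cases l with
  | nil => simp
  | cons c l => exact bar_cons_cons a c l

/-- On words of length `q + 1`, `t d_i = -d_{i+1} t`. Applying `t` to `b'` thus shifts the faces
`d_0, …, d_{q-1}` to `d_1, …, d_q`: the face `d_0` is lost, and `(-1)^q d_q = d_0 t` is gained. Both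
compatibilities of the vertical differentials with `1 - t` and `N` rest on this relation. -/
theorem tW_bar (e : Words α) :
    tW (bar e) = bar (tW e) - mulHead (tW e) + mulHead (tW (tW e)) := by
  refine LinearMap.congr_fun (words_hom_ext (f := tW ∘ₗ bar)
    (g := bar ∘ₗ tW - mulHead ∘ₗ tW + mulHead ∘ₗ tW ∘ₗ tW) fun l => ?_) e
  simp only [LinearMap.comp_apply, LinearMap.sub_apply, LinearMap.add_apply]
  induction l using List.reverseRecOn with
  | nil => simp
  | append_singleton l z _ =>
    induction l using List.reverseRecOn with
    | nil =>
      have h := tW_concat [] z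
      simp only [List.nil_append, List.length_nil, pow_zero, one_smul] at h
      simp [h]
    | append_singleton m y _ =>
      have h1 : tW (snocW z (bar (word (m ++ [y])))) =
          (-1 : ℤ) ^ m.length • consW z (bar (word (m ++ [y]))) :=
        tW_snocW z (bar_word_mem_ofLength _ (by simp))
      have h2 : mulHead (word (y :: z :: m)) =
          (-1 : ℤ) ^ m.length • tW (prependW m (mulHead (word [y, z]))) := by
        cases y <;> cases z <;> simp [smul_smul, ← mul_pow]
      have h3 : tW (tW (word (m ++ [y, z]))) = word (y :: z :: m) := by
        have := tW_concat (m ++ [y]) z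
        rw [List.append_assoc] at this
        simp only [List.cons_append, List.nil_append] at this
        rw [this, map_smul, ← List.cons_append, tW_concat]
        simp [smul_smul, ← mul_pow]
      have h4 := tW_concat (m ++ [y]) z
      rw [List.append_assoc] at h4 ⊢
      simp only [List.cons_append, List.nil_append] at h4 ⊢
      rw [h3, h2, bar_concat_concat, map_add, h1, h4, map_smul, map_smul, bar_cons, map_smul]
      simp [pow_succ, smul_sub]

theorem hoch_sub_tW (e : Words α) : hoch (e - tW e) = bar e - tW (bar e) := by
  simp only [hoch, LinearMap.add_apply, LinearMap.comp_apply, map_sub, tW_bar]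
  abel

theorem bar_tW_pow (i : ℕ) (e : Words α) :
    bar ((tW ^ i) e) = (tW ^ i) (bar e) +
      ∑ j ∈ Finset.range i, (tW ^ j) (mulHead ((tW ^ (i - j)) e - (tW ^ (i - j + 1)) e)) := by
  induction i with
  | zero => simp
  | succ i ih =>
    have h := tW_bar ((tW ^ i) e)
    rw [Finset.sum_range_succ']
    simp only [Nat.add_sub_add_right, pow_succ' tW, Module.End.mul_apply, pow_zero,
      Module.End.one_apply, Nat.sub_zero, map_sub] at ih h ⊢
    rw [ih, map_add, map_sum] at h
    simp only [map_sub] at h ⊢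
    rw [← add_assoc, h]
    abel

/-- For each `j`, the correction terms of `bar_tW_pow` telescope when summed over the exponent of
the rotation. -/
theorem bar_sum_tW_pow (n : ℕ) (e : Words α) :
    bar (∑ i ∈ Finset.range (n + 1), (tW ^ i) e) =
      ∑ i ∈ Finset.range (n + 1), (tW ^ i) (bar e) +
      ∑ j ∈ Finset.range n, (tW ^ j) (mulHead (tW e - (tW ^ (n + 1 - j)) e)) := by
  induction n with
  | zero => simp
  | succ n ih =>
    have h0 : ∑ j ∈ Finset.range n, (tW ^ j) (mulHead (tW e - (tW ^ (n + 1 - j)) e)) =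
        ∑ j ∈ Finset.range (n + 1), (tW ^ j) (mulHead (tW e - (tW ^ (n + 1 - j)) e)) := by
      rw [Finset.sum_range_succ]; simp
    rw [Finset.sum_range_succ, map_add, ih, h0, bar_tW_pow, Finset.sum_range_succ _ (n + 1)]
    rw [add_add_add_comm, ← Finset.sum_add_distrib]
    congr 1
    refine Finset.sum_congr rfl fun j hj => ?_
    rw [← map_add, ← map_add, show n + 1 + 1 - j = n + 1 - j + 1 by
      have := Finset.mem_range.1 hj; omega]
    congr 2
    abel

theorem bar_eq_sum_prependW : ∀ l : List (Option α), bar (word l) =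
    ∑ j ∈ Finset.range (l.length - 1),
      (-1 : ℤ) ^ j • prependW (l.take j) (mulHead (word (l.drop j)))
  | [] => by simp
  | [a] => by simp
  | a :: c :: l => by
    rw [bar_cons_cons, bar_eq_sum_prependW (c :: l)]
    simp only [List.length_cons, Nat.add_sub_cancel]
    rw [Finset.sum_range_succ']
    simp only [List.take_succ_cons, List.drop_succ_cons, ← consW_prependW, map_sum, map_smul,
      pow_succ, mul_neg, mul_one, neg_smul, Finset.sum_neg_distrib]
    simp [sub_eq_neg_add]

/-- The signed face `(-1)^j d_j` is `d_0` conjugated by `t^j`: rotate the pair to be multiplied to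
the front, multiply, rotate back. The inverse rotation is written as `t ^ (l.length - j)`. -/
theorem prependW_mulHead_eq (l : List (Option α)) {j : ℕ} (hj : j < l.length - 1) :
    (-1 : ℤ) ^ j • prependW (l.take j) (mulHead (word (l.drop j))) =
      (tW ^ j) (mulHead ((tW ^ (l.length - j)) (word l))) := by
  obtain ⟨u, v, rfl, rfl⟩ : ∃ u v, l = u ++ v ∧ u.length = j :=
    ⟨l.take j, l.drop j, (List.take_append_drop j l).symm, by simp; omega⟩
  rw [List.take_left, List.drop_left, List.length_append, Nat.add_sub_cancel_left, tW_pow_append]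
  have key : ∀ a v', (tW ^ u.length) (word (a :: (v' ++ u))) =
      (-1 : ℤ) ^ ((v'.length + u.length) * u.length) • word (u ++ a :: v') := fun a v' => by
    rw [← List.cons_append, tW_pow_append]
    congr 2
    simp only [List.length_cons]
    congr 1
    omega
  -- Parity of the total sign of the two rotations; the second acts on a word shorter by one, and `k
  -- + 2` is the length of the part rotated first.
  have hs : ∀ k : ℕ, (-1 : ℤ) ^ u.length =
      (-1) ^ ((u.length + (k + 1 + 1) - 1) * (k + 1 + 1)) * (-1) ^ ((k + u.length) * u.length) := by
    intro k
    rw [← pow_add]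
    by_cases h : Even u.length <;> by_cases h' : Even k <;>
    · rw [show u.length + (k + 1 + 1) - 1 = u.length + k + 1 by omega]
      simp only [neg_one_pow_eq_ite]
      congr 1
      simp [h, h', parity_simps]
  match v, hj with
  | none :: c :: v, _ =>
    simp only [List.length_cons, List.cons_append, mulHead_none, map_smul, key, prependW_word,
      smul_smul]
    rw [hs]
  | some x :: none :: v, _ =>
    simp only [List.length_cons, List.cons_append, mulHead_some_none, map_smul, key, prependW_word,
      smul_smul]
    rw [hs]
  | some x :: some y :: v, _ => simp
  | [a], h => simp at h
  | [], h => simp at h; omega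

theorem bar_eq_sum_tW (l : List (Option α)) : bar (word l) =
    ∑ j ∈ Finset.range (l.length - 1), (tW ^ j) (mulHead ((tW ^ (l.length - j)) (word l))) := by
  rw [bar_eq_sum_prependW]
  exact Finset.sum_congr rfl fun j hj => prependW_mulHead_eq l (Finset.mem_range.1 hj)

theorem NW_of_length {n : ℕ} {e : Words α} (he : e ∈ ofLength α n) :
    NW e = ∑ i ∈ Finset.range n, (tW ^ i) e := by
  have := eqOn_wordsIn (f := NW) (g := ∑ i ∈ Finset.range n, tW ^ i) (fun l hl => by
    rw [NW_word, hl, LinearMap.sum_apply]) he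
  rw [this, LinearMap.sum_apply]

theorem tW_pow_of_length {n : ℕ} {e : Words α} (he : e ∈ ofLength α n) : (tW ^ n) e = e :=
  eqOn_wordsIn (f := tW ^ n) (g := LinearMap.id) (fun l hl => by
    rw [← hl, tW_pow_length]; rfl) he

/-- On length `q + 1` the sum of `q + 1` rotations of `bar e`, which has length `q`, counts `bar e`
once too often. That surplus cancels the terms that `bar_eq_sum_tW` identifies with `bar e`, and
what is left is `N` applied to `bar + d_0 t`. -/
theorem bar_NW (e : Words α) : bar (NW e) = NW (hoch e) := by
  refine LinearMap.congr_fun (words_hom_ext (f := bar ∘ₗ NW) (g := NW ∘ₗ hoch) fun l => ?_) e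
  simp only [LinearMap.comp_apply]
  rcases hl : l.length with _ | q
  · rw [List.length_eq_zero_iff] at hl
    subst hl
    simp [NW_word, hoch]
  · have h1 := hoch_mem_ofLength (word_mem_wordsIn (p := fun l => l.length = q + 1) hl)
    rw [NW_of_length h1, NW_word, hl, bar_sum_tW_pow, Finset.sum_range_succ,
      tW_pow_of_length (bar_word_mem_ofLength l hl)]
    have h2 := bar_eq_sum_tW l
    rw [hl, Nat.add_sub_cancel] at h2
    simp only [map_sub, Finset.sum_sub_distrib]
    rw [← h2]
    simp only [hoch, LinearMap.add_apply, LinearMap.comp_apply, map_add, Finset.sum_add_distrib]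
    abel

theorem tW_NW (e : Words α) : tW (NW e) = NW e := by
  refine LinearMap.congr_fun (words_hom_ext (f := tW ∘ₗ NW) (g := NW) fun l => ?_) e
  rw [LinearMap.comp_apply, NW_word, map_sum]
  have h := Finset.sum_range_succ' (fun i => (tW ^ i) (word l)) l.length
  rw [Finset.sum_range_succ, tW_pow_length, pow_zero, Module.End.one_apply] at h
  rw [add_right_cancel h]
  exact Finset.sum_congr rfl fun i _ => by rw [pow_succ', Module.End.mul_apply]

theorem NW_tW (e : Words α) : NW (tW e) = NW e := by
  refine LinearMap.congr_fun (words_hom_ext (f := NW ∘ₗ tW) (g := NW) fun l => ?_) e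
  have hl := word_mem_wordsIn (p := fun m => m.length = l.length) (l := l) rfl
  rw [LinearMap.comp_apply, NW_of_length (tW_mem_ofLength hl), NW_of_length hl]
  have h := Finset.sum_range_succ' (fun i => (tW ^ i) (word l)) l.length
  rw [Finset.sum_range_succ, tW_pow_length, pow_zero, Module.End.one_apply] at h
  rw [add_right_cancel h]
  exact Finset.sum_congr rfl fun i _ => by rw [pow_succ, Module.End.mul_apply]

/-! ### The contraction of the Hochschild columns -/

/-- Double the first unit of a list, with the sign of its position. -/
def doubleUnit : List (Option α) → Words α
  | [] => 0
  | none :: l => word (none :: none :: l)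
  | some x :: l => -consW (some x) (doubleUnit l)

/-- Double the first unit of a word which is not at the head. -/
def homotopyFun : List (Option α) → Words α
  | [] => 0
  | a :: l => consW a (doubleUnit l)

/-- The contracting homotopy of the degenerate part of the Hochschild complex. -/
def homotopy : Words α →ₗ[ℤ] Words α := extend homotopyFun

@[simp] theorem homotopy_nil : homotopy (word ([] : List (Option α))) = 0 := extend_word _ _
theorem homotopy_cons (a : Option α) (l) : homotopy (word (a :: l)) = consW a (doubleUnit l) :=
  extend_word _ _

theorem homotopy_consW_none (a : Option α) (e : Words α) :
    homotopy (consW a (consW none e)) = consW a (consW none (consW none e)) :=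
  LinearMap.congr_fun (words_hom_ext (f := homotopy ∘ₗ consW a ∘ₗ consW none)
    (g := consW a ∘ₗ consW none ∘ₗ consW none) fun l => by simp [homotopy_cons, doubleUnit]) e

theorem homotopy_consW_some (a : Option α) (x : α) (e : Words α) :
    homotopy (consW a (consW (some x) e)) = -consW a (homotopy (consW (some x) e)) :=
  LinearMap.congr_fun (words_hom_ext (f := homotopy ∘ₗ consW a ∘ₗ consW (some x))
    (g := -(consW a ∘ₗ homotopy ∘ₗ consW (some x)))
    fun l => by simp [homotopy_cons, doubleUnit]) e

theorem bar_cons_some (x : α) (l) : ∃ e, bar (word (some x :: l)) = consW (some x) e := by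
  rcases l with _ | ⟨_ | y, l⟩
  · exact ⟨0, by simp⟩
  · exact ⟨word l - bar (word (none :: l)), by simp [bar_cons_cons]⟩
  · exact ⟨-bar (word (some y :: l)), by simp [bar_cons_cons]⟩

theorem mulHead_cons_none (a : Option α) (l) :
    mulHead (word (a :: none :: l)) = word (a :: l) := by
  cases a <;> simp

theorem bar_consW_consW_some (a : Option α) (x : α) (e : Words α) :
    bar (consW a (consW (some x) e)) =
      mulHead (consW a (consW (some x) e)) - consW a (bar (consW (some x) e)) :=
  LinearMap.congr_fun (words_hom_ext (f := bar ∘ₗ consW a ∘ₗ consW (some x))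
    (g := mulHead ∘ₗ consW a ∘ₗ consW (some x) - consW a ∘ₗ bar ∘ₗ consW (some x))
    fun l => by simp [bar_cons_cons]) e

theorem mulHead_consW_some_homotopy (a : Option α) (x : α) (l) :
    mulHead (consW a (homotopy (word (some x :: l)))) =
      homotopy (mulHead (word (a :: some x :: l))) := by
  rw [homotopy_cons]
  have h : ∀ e : Words α, mulHead (consW none (consW (some x) e)) = consW (some x) e := fun e =>
    LinearMap.congr_fun (words_hom_ext (f := mulHead ∘ₗ consW none ∘ₗ consW (some x))
      (g := consW (some x)) fun l => by simp) e
  have h' : ∀ y (e : Words α), mulHead (consW (some y) (consW (some x) e)) = 0 := fun y e =>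
    LinearMap.congr_fun (words_hom_ext (f := mulHead ∘ₗ consW (some y) ∘ₗ consW (some x))
      (g := 0) fun l => by simp) e
  cases a <;> simp [h, h', homotopy_cons]

/-- The two copies of a doubled unit merge back to the word, and the other faces cancel against the
doubled faces. A unit in the last place escapes: the bar differential has only one face that removes
it, where an interior unit has two. Hence only the units strictly between head and end count here.
-/
theorem bar_homotopy_cons (a : Option α) (l : List (Option α)) :
    bar (homotopy (word (a :: l))) + homotopy (bar (word (a :: l))) =
      if l.dropLast.all Option.isSome then 0 else word (a :: l) := by
  induction l generalizing a with
  | nil => simp [homotopy_cons, doubleUnit]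
  | cons y l ih =>
    cases y with
    | none =>
      cases l with
      | nil => simp [homotopy_cons, doubleUnit, bar_cons_cons, mulHead_cons_none]
      | cons c l =>
        rw [homotopy_cons]
        simp only [doubleUnit, consW_word]
        rw [bar_cons_cons, bar_cons_cons none none, bar_cons_cons none c, bar_cons_cons a none,
          bar_cons_cons none c]
        simp [mulHead_cons_none, homotopy_consW_none]
    | some x =>
      have h1 : homotopy (word (a :: some x :: l)) = -consW a (homotopy (word (some x :: l))) := by
        simpa using homotopy_consW_some a x (word l)
      obtain ⟨e, he⟩ := bar_cons_some x l
      have h2 : homotopy (consW a (bar (word (some x :: l)))) =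
          -consW a (homotopy (bar (word (some x :: l)))) := by
        rw [he, homotopy_consW_some]
      have h3 : bar (consW a (homotopy (word (some x :: l)))) =
          mulHead (consW a (homotopy (word (some x :: l)))) -
            consW a (bar (homotopy (word (some x :: l)))) := by
        rw [homotopy_cons, bar_consW_consW_some]
      have h4 : consW a (bar (homotopy (word (some x :: l)))) =
          consW a (if l.dropLast.all Option.isSome then 0 else word (some x :: l)) -
          consW a (homotopy (bar (word (some x :: l)))) := by
        rw [← ih, map_add, add_sub_cancel_right]
      rw [h1, bar_cons_cons, map_neg, h3, mulHead_consW_some_homotopy, map_sub, h2, h4]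
      cases l with
      | nil => simp
      | cons c l =>
        simp only [List.dropLast_cons_cons, List.all_cons, Option.isSome_some, Bool.true_and]
        split_ifs
        · simp
        · simp only [consW_word]
          abel

theorem doubleUnit_of_all : ∀ {l : List (Option α)}, l.all Option.isSome → doubleUnit l = 0
  | [], _ => rfl
  | some x :: l, h => by
    rw [doubleUnit, doubleUnit_of_all (by simpa using h)]; simp
  | none :: l, h => by simp at h

theorem doubleUnit_concat_of_not_all (z : Option α) : ∀ {l : List (Option α)},
    ¬ l.all Option.isSome → doubleUnit (l ++ [z]) = snocW z (doubleUnit l)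
  | [], h => by simp at h
  | some x :: l, h => by
    rw [List.cons_append, doubleUnit, doubleUnit,
      doubleUnit_concat_of_not_all z (by simpa using h), consW_snocW, map_neg]
  | none :: l, h => by simp [doubleUnit]

theorem doubleUnit_concat_none : ∀ {l : List (Option α)}, l.all Option.isSome →
    doubleUnit (l ++ [none]) = (-1 : ℤ) ^ l.length • word (l ++ [none, none])
  | [], _ => by simp [doubleUnit]
  | some x :: l, h => by
    rw [List.cons_append, doubleUnit, doubleUnit_concat_none (by simpa using h), map_smul]
    simp [pow_succ]
  | none :: l, h => by simp at h

theorem doubleUnit_mem : ∀ l : List (Option α), doubleUnit l ∈ ofLength α (l.length + 1)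
  | [] => zero_mem _
  | none :: l => word_mem_wordsIn (by simp)
  | some x :: l => neg_mem (consW_mem_ofLength _ (doubleUnit_mem l))

/-- The cyclic face supplies exactly what `bar_homotopy_cons` misses. If the only unit away from the
head is the last entry, merging the doubled unit around the circle returns the word; otherwise the
homotopy anticommutes with this face. -/
theorem lastFace_homotopy_cons_concat (a z : Option α) (l : List (Option α)) :
    mulHead (tW (homotopy (word (a :: (l ++ [z]))))) +
      homotopy (mulHead (tW (word (a :: (l ++ [z]))))) =
      if l.all Option.isSome ∧ z = none then word (a :: (l ++ [z])) else 0 := by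
  have ht : tW (word (a :: (l ++ [z]))) = (-1 : ℤ) ^ (l.length + 1) • word (z :: a :: l) := by
    rw [← List.cons_append, tW_concat]; simp
  rw [homotopy_cons, ht, map_smul, map_smul]
  by_cases h : l.all Option.isSome
  · have hz : homotopy (mulHead (word (z :: a :: l))) = 0 := by
      cases a <;> cases z <;> simp [homotopy_cons, doubleUnit_of_all h]
    rw [hz, smul_zero, add_zero]
    cases z with
    | none =>
      have := tW_concat (a :: (l ++ [none])) none
      simp only [List.cons_append, List.append_assoc, List.nil_append] at this
      simp [doubleUnit_concat_none h, this, smul_smul, ← pow_add, h]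
      rw [Even.neg_one_pow ⟨l.length + 1, by ring⟩, one_smul]
    | some x =>
      rw [doubleUnit_of_all (by simpa using h)]
      simp
  · rw [if_neg (fun h' => h h'.1), doubleUnit_concat_of_not_all z h, consW_snocW,
      tW_snocW z (consW_mem_ofLength a (doubleUnit_mem l)), map_smul]
    have : mulHead (consW z (consW a (doubleUnit l))) =
        homotopy (mulHead (word (z :: a :: l))) := by
      have h1 : ∀ c (e : Words α), mulHead (consW none (consW c e)) = consW c e := fun c e =>
        LinearMap.congr_fun (words_hom_ext (f := mulHead ∘ₗ consW none ∘ₗ consW c)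
          (g := consW c) fun l => by simp) e
      have h2 : ∀ x y (e : Words α), mulHead (consW (some y) (consW (some x) e)) = 0 := fun x y e =>
        LinearMap.congr_fun (words_hom_ext (f := mulHead ∘ₗ consW (some y) ∘ₗ consW (some x))
          (g := 0) fun l => by simp) e
      have h3 : ∀ y (e : Words α), mulHead (consW (some y) (consW none e)) = consW (some y) e :=
        fun y e =>
        LinearMap.congr_fun (words_hom_ext (f := mulHead ∘ₗ consW (some y) ∘ₗ consW none)
          (g := consW (some y)) fun l => by simp) e
      cases a <;> cases z <;> simp [h1, h2, h3, homotopy_cons]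
    rw [this]
    simp [pow_succ]

/-! ### The projections onto the words with no unit and with one unit at the head -/

/-- The projection onto the words without units. -/
def projQ : Words α →ₗ[ℤ] Words α := extend fun l => if l.all Option.isSome then word l else 0

/-- The letters of the words with exactly one unit, at the head. -/
def projPFun : List (Option α) → Words α
  | none :: l => projQ (word l)
  | _ => 0

/-- The linear extension of `projPFun`. -/
def projP : Words α →ₗ[ℤ] Words α := extend projPFun

theorem projQ_word (l : List (Option α)) :
    projQ (word l) = if l.all Option.isSome then word l else 0 := extend_word _ _
@[simp] theorem projP_nil : projP (word ([] : List (Option α))) = 0 := extend_word _ _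
@[simp] theorem projP_consW_none (e : Words α) : projP (consW none e) = projQ e :=
  LinearMap.congr_fun (words_hom_ext (f := projP ∘ₗ consW none) (g := projQ)
    fun l => by simp [projP, projPFun]) e
@[simp] theorem projP_consW_some (x : α) (e : Words α) : projP (consW (some x) e) = 0 :=
  LinearMap.congr_fun (words_hom_ext (f := projP ∘ₗ consW (some x)) (g := 0)
    fun l => by simp [projP, projPFun]) e
@[simp] theorem projQ_consW_none (e : Words α) : projQ (consW none e) = 0 :=
  LinearMap.congr_fun (words_hom_ext (f := projQ ∘ₗ consW none) (g := 0)
    fun l => by simp [projQ_word]) e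
@[simp] theorem projQ_consW_some (x : α) (e : Words α) :
    projQ (consW (some x) e) = consW (some x) (projQ e) :=
  LinearMap.congr_fun (words_hom_ext (f := projQ ∘ₗ consW (some x)) (g := consW (some x) ∘ₗ projQ)
    fun l => by simp only [LinearMap.comp_apply, consW_word, projQ_word]; split_ifs <;> simp_all) e
@[simp] theorem projP_none (l : List (Option α)) : projP (word (none :: l)) = projQ (word l) := by
  rw [← consW_word, projP_consW_none]
@[simp] theorem projP_some (x : α) (l) : projP (word (some x :: l)) = 0 := by
  rw [← consW_word, projP_consW_some]
@[simp] theorem projQ_none (l : List (Option α)) : projQ (word (none :: l)) = 0 := by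
  rw [← consW_word, projQ_consW_none]
@[simp] theorem projQ_some (x : α) (l) :
    projQ (word (some x :: l)) = consW (some x) (projQ (word l)) := by
  rw [← consW_word, projQ_consW_some]
@[simp] theorem projQ_nil : projQ (word ([] : List (Option α))) = word [] := by
  simp [projQ_word]

/-- The bar part and the cyclic part of the homotopy add up to the identity on the words having a
unit away from the head, and to zero on the others, which the two projections recover. -/
theorem hoch_homotopy (e : Words α) :
    hoch (homotopy e) + homotopy (hoch e) + consW none (projP e) + projQ e = e := by
  refine LinearMap.congr_fun (words_hom_ext (f := hoch ∘ₗ homotopy + homotopy ∘ₗ hoch +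
    consW none ∘ₗ projP + projQ) (g := LinearMap.id) fun l => ?_) e
  simp only [LinearMap.add_apply, LinearMap.comp_apply, LinearMap.id_apply, hoch, map_add]
  cases l with
  | nil => simp
  | cons a l =>
    have hPQ : consW none (projP (word (a :: l))) + projQ (word (a :: l)) =
        if l.all Option.isSome then word (a :: l) else 0 := by
      cases a <;>
      · simp [projQ_word]
        try split_ifs <;> simp
    rw [add_assoc, hPQ]
    rw [add_add_add_comm, bar_homotopy_cons]
    induction l using List.reverseRecOn with
    | nil =>
      have : tW (word [a]) = word [a] := by simpa using tW_concat [] a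
      simp [this, homotopy_cons, doubleUnit]
    | append_singleton l z _ =>
      rw [lastFace_homotopy_cons_concat, List.dropLast_concat]
      cases z <;> by_cases h : l.all Option.isSome <;> simp [h]

/-- This contracts the odd columns. The empty word has to be excluded, since a single unit has no
face that removes it. -/
theorem bar_consW_none (e : Words α) (he : e [] = 0) :
    bar (consW none e) = e - consW none (bar e) := by
  have h : bar ∘ₗ consW none = LinearMap.id - consW none ∘ₗ bar -
      (Finsupp.lapply ([] : List (Option α))).smulRight (word []) := by
    refine words_hom_ext fun l => ?_
    cases l with
    | nil =>
      have : (word [] : Words α) [] = 1 := by simp [word]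
      simp [this]
    | cons c l =>
      have : (word (c :: l) : Words α) [] = 0 := by simp [word]
      simp [bar_cons_cons, this]
  have := LinearMap.congr_fun h e
  simpa [he] using this

theorem projQ_tW (e : Words α) : projQ (tW e) = tW (projQ e) := by
  refine LinearMap.congr_fun (words_hom_ext (f := projQ ∘ₗ tW) (g := tW ∘ₗ projQ) fun l => ?_) e
  induction l using List.reverseRecOn with
  | nil => simp
  | append_singleton l z _ =>
    simp only [LinearMap.comp_apply, tW_concat, map_smul, projQ_word]
    have : (z :: l).all Option.isSome = (l ++ [z]).all Option.isSome := by
      simp [Bool.and_comm]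
    rw [this]
    split_ifs <;> simp

theorem projQ_tW_pow (i : ℕ) (e : Words α) : projQ ((tW ^ i) e) = (tW ^ i) (projQ e) := by
  induction i with
  | zero => simp
  | succ i ih => rw [pow_succ', Module.End.mul_apply, projQ_tW, ih, Module.End.mul_apply]

theorem projQ_NW (e : Words α) : projQ (NW e) = NW (projQ e) := by
  refine LinearMap.congr_fun (words_hom_ext (f := projQ ∘ₗ NW) (g := NW ∘ₗ projQ) fun l => ?_) e
  simp only [LinearMap.comp_apply, NW_word, map_sum, projQ_tW_pow, projQ_word l]
  split_ifs <;> simp [NW_word]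

theorem projQ_doubleUnit : ∀ l : List (Option α), projQ (doubleUnit l) = 0
  | [] => by simp [doubleUnit]
  | none :: l => by simp [doubleUnit]
  | some x :: l => by simp [doubleUnit, projQ_doubleUnit l]

theorem projQ_homotopy (e : Words α) : projQ (homotopy e) = 0 := by
  refine LinearMap.congr_fun (words_hom_ext (f := projQ ∘ₗ homotopy) (g := 0) fun l => ?_) e
  rcases l with _ | ⟨_ | x, l⟩ <;> simp [homotopy_cons, projQ_doubleUnit]

theorem projP_homotopy (e : Words α) : projP (homotopy e) = 0 := by
  refine LinearMap.congr_fun (words_hom_ext (f := projP ∘ₗ homotopy) (g := 0) fun l => ?_) e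
  rcases l with _ | ⟨_ | x, l⟩ <;> simp [homotopy_cons, projQ_doubleUnit]

theorem projP_tW_cons_none {l : List (Option α)} (hl : l ≠ []) :
    projP (tW (word (none :: l))) = 0 := by
  obtain ⟨u, z, rfl⟩ := List.eq_nil_or_concat'  l |>.resolve_left hl
  rw [← List.cons_append, tW_concat]
  cases z <;> simp

theorem projP_tW_cons_some (x : α) {l : List (Option α)} (hl : l ≠ []) :
    projP (tW (word (some x :: l))) = -consW (some x) (projP (tW (word l))) := by
  obtain ⟨u, z, rfl⟩ := List.eq_nil_or_concat'  l |>.resolve_left hl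
  rw [← List.cons_append, tW_concat, tW_concat]
  cases z <;> simp [pow_succ]

theorem tW_single (a : Option α) : tW (word [a]) = word [a] := by
  simpa using tW_concat [] a

/-- Only a word with exactly one unit can contribute. An interior unit is removed by two consecutive
faces with opposite signs; a unit at the head or at the end is removed by one face of the bar
differential. -/
theorem projQ_bar (e : Words α) : projQ (bar e) = projP e - projP (tW e) := by
  refine LinearMap.congr_fun (words_hom_ext (f := projQ ∘ₗ bar) (g := projP - projP ∘ₗ tW)
    fun l => ?_) e
  simp only [LinearMap.comp_apply, LinearMap.sub_apply]
  induction l with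
  | nil => simp
  | cons a l ih =>
    rcases l with _ | ⟨_ | y, l⟩
    · simp [tW_single]
    · rw [bar_cons_cons]
      cases a with
      | none => simp [projP_tW_cons_none]
      | some x =>
        rw [projP_tW_cons_some x (by simp), map_sub, projQ_consW_some, ih]
        simp
    · rw [bar_cons_cons]
      cases a with
      | none => simp [projP_tW_cons_none]
      | some x =>
        rw [projP_tW_cons_some x (by simp), map_sub, projQ_consW_some, ih]
        simp

/-- The cyclic face multiplies the last entry with the head, so it removes a unit standing at either
of these places. The first term cancels against the unit at the end in `projQ_bar`. -/
theorem projQ_mulHead_tW (e : Words α) :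
    projQ (mulHead (tW e)) = projP (tW e) - tW (projP e) := by
  refine LinearMap.congr_fun (words_hom_ext (f := projQ ∘ₗ mulHead ∘ₗ tW)
    (g := projP ∘ₗ tW - tW ∘ₗ projP) fun l => ?_) e
  simp only [LinearMap.comp_apply, LinearMap.sub_apply]
  induction l using List.reverseRecOn with
  | nil => simp
  | append_singleton l z _ =>
    rw [tW_concat]
    rcases l with _ | ⟨_ | y, l⟩
    · cases z <;> simp
    · cases z with
      | none => simp [← projQ_tW]
      | some x =>
        have := tW_concat l (some x)
        simp [← projQ_tW, this, pow_succ]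
    · cases z <;> simp

theorem projQ_hoch (e : Words α) : projQ (hoch e) = projP e - tW (projP e) := by
  rw [hoch, LinearMap.add_apply, map_add, projQ_bar, LinearMap.comp_apply, projQ_mulHead_tW]
  abel

/-- A contributing word has a unit at the head and one more unit. Two cyclically consecutive faces
remove the second one, with opposite signs and the same result. -/
theorem projP_hoch (e : Words α) : projP (hoch e) = 0 := by
  refine LinearMap.congr_fun (words_hom_ext (f := projP ∘ₗ hoch) (g := 0) fun l => ?_) e
  simp only [LinearMap.comp_apply, LinearMap.zero_apply, hoch, LinearMap.add_apply]
  rcases l with _ | ⟨a, l⟩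
  · simp
  induction l using List.reverseRecOn with
  | nil => simp [tW_single]
  | append_singleton u z _ =>
    have ht := tW_concat (a :: u) z
    rw [List.cons_append] at ht
    have hc : bar (word (a :: (u ++ [z]))) =
        mulHead (word (a :: (u ++ [z]))) - consW a (bar (word (u ++ [z]))) := bar_cons _ _
    rw [hc, ht]
    cases a with
    | some x =>
      have : projP (mulHead (word (some x :: (u ++ [z])))) = 0 := by
        rcases u with _ | ⟨_ | y, u⟩ <;> cases z <;> simp
      cases z <;> simp [this]
    | none =>
      have : mulHead (word (none :: (u ++ [z]))) = word (u ++ [z]) := by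
        cases u <;> simp
      rw [this, map_add, map_sub, projP_consW_none, projQ_bar, tW_concat]
      cases z <;> simp [pow_succ]

/-- This is how the contraction of an odd column leaks into the next even column: rotating a unit
away from the head of a word of length at least two leaves a unit that is not at the head, or a
second unit. -/
theorem projP_sub_tW_consW_none (e : Words α) (he : e [] = 0) :
    projP (consW none e - tW (consW none e)) = projQ e := by
  have h : projP ∘ₗ tW ∘ₗ consW none =
      (Finsupp.lapply ([] : List (Option α))).smulRight (word []) := by
    refine words_hom_ext fun l => ?_
    cases l with
    | nil =>
      have h1 : (word [] : Words α) [] = 1 := by simp [word]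
      simp [h1, tW_single]
    | cons c l =>
      have h1 : (word (c :: l) : Words α) [] = 0 := by simp [word]
      simp [h1, projP_tW_cons_none]
  have := LinearMap.congr_fun h e
  simp only [LinearMap.comp_apply, LinearMap.smulRight_apply, Finsupp.lapply_apply, he,
    zero_smul] at this
  rw [map_sub, this, projP_consW_none, sub_zero]

theorem bar_letters : ∀ {l : List (Option α)}, l.all Option.isSome → bar (word l) = 0
  | [], _ => by simp
  | [_], _ => by simp
  | some x :: some y :: l, h => by
    rw [bar_cons_cons, bar_letters (l := some y :: l) (by simpa using h)]; simp

theorem hoch_projQ (e : Words α) : hoch (projQ e) = 0 := by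
  refine LinearMap.congr_fun (words_hom_ext (f := hoch ∘ₗ projQ) (g := 0) fun l => ?_) e
  simp only [LinearMap.comp_apply, LinearMap.zero_apply, projQ_word]
  split_ifs with h
  · rw [hoch, LinearMap.add_apply, bar_letters h, zero_add, LinearMap.comp_apply]
    induction l using List.reverseRecOn with
    | nil => simp
    | append_singleton l z _ =>
      rw [tW_concat]
      rcases l with _ | ⟨_ | y, l⟩ <;> cases z <;> simp_all
  · simp

theorem hoch_consW_none_projQ (e : Words α) :
    hoch (consW none (projQ e)) = projQ e - tW (projQ e) := by
  refine LinearMap.congr_fun (words_hom_ext (f := hoch ∘ₗ consW none ∘ₗ projQ)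
    (g := projQ - tW ∘ₗ projQ) fun l => ?_) e
  simp only [LinearMap.comp_apply, LinearMap.sub_apply, projQ_word]
  split_ifs with h
  · rw [hoch, LinearMap.add_apply, LinearMap.comp_apply, consW_word, bar_cons, bar_letters h]
    induction l using List.reverseRecOn with
    | nil => simp [tW_single]
    | append_singleton l z _ =>
      rw [← List.cons_append, tW_concat, tW_concat]
      cases z with
      | none => simp at h
      | some x => cases l <;> simp [pow_succ, sub_eq_add_neg]
  · simp

/-! ### Length and weight -/

/-- The number of letters of a word. -/
def wordWeight (l : List (Option α)) : ℕ := l.countP Option.isSome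

@[simp] theorem wordWeight_nil : wordWeight ([] : List (Option α)) = 0 := rfl
@[simp] theorem wordWeight_none (l : List (Option α)) : wordWeight (none :: l) = wordWeight l := by
  simp [wordWeight]
@[simp] theorem wordWeight_some (x : α) (l) : wordWeight (some x :: l) = wordWeight l + 1 := by
  simp [wordWeight]
@[simp] theorem wordWeight_rotList (l : List (Option α)) :
    wordWeight (rotList l) = wordWeight l :=
  (List.rotate_perm _ _).countP_eq _

theorem wordWeight_eq_length_iff (l : List (Option α)) :
    wordWeight l = l.length ↔ l.all Option.isSome := by
  rw [wordWeight, List.countP_eq_length, List.all_eq_true]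

/-- The span of the nonempty words of length `n` and weight `w`. -/
def homog (α : Type) (n : ℤ) (w : ℕ) : Submodule ℤ (Words α) :=
  wordsIn fun l => l ≠ [] ∧ (l.length : ℤ) = n ∧ wordWeight l = w

theorem word_mem_homog {l : List (Option α)} {n : ℤ} {w : ℕ} (h : l ≠ [])
    (hn : (l.length : ℤ) = n) (hw : wordWeight l = w) : word l ∈ homog α n w :=
  word_mem_wordsIn ⟨h, hn, hw⟩

theorem apply_nil_of_mem_homog {n : ℤ} {w : ℕ} {e : Words α} (he : e ∈ homog α n w) :
    e [] = 0 :=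
  eqOn_wordsIn (f := Finsupp.lapply []) (g := 0) (fun l hl => by simp [word, hl.1]) he

theorem eq_zero_of_mem_homog {n : ℤ} {w : ℕ} {e : Words α} (he : e ∈ homog α n w)
    (hn : n ≤ 0) : e = 0 :=
  eqOn_wordsIn (f := LinearMap.id) (g := 0) (fun l hl => by
    have := List.length_pos_iff.2 hl.1
    omega) he

theorem tW_mem_homog {n : ℤ} {w : ℕ} {e : Words α} (he : e ∈ homog α n w) :
    tW e ∈ homog α n w := by
  refine map_mem_of_wordsIn (fun l hl => ?_) he
  rw [tW, extend_word]
  refine Submodule.smul_mem _ _ (word_mem_homog ?_ (by simpa using hl.2.1) (by simpa using hl.2.2))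
  rw [rotList, Ne, List.rotate_eq_nil_iff]
  exact hl.1

theorem tW_pow_mem_homog {n : ℤ} {w : ℕ} (i : ℕ) {e : Words α} (he : e ∈ homog α n w) :
    (tW ^ i) e ∈ homog α n w := by
  induction i with
  | zero => simpa
  | succ i ih => rw [pow_succ', Module.End.mul_apply]; exact tW_mem_homog ih

theorem NW_mem_homog {n : ℤ} {w : ℕ} {e : Words α} (he : e ∈ homog α n w) :
    NW e ∈ homog α n w := by
  refine map_mem_of_wordsIn (fun l hl => ?_) he
  rw [NW_word]
  exact sum_mem fun i _ => tW_pow_mem_homog i (word_mem_wordsIn hl)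

theorem consW_none_mem_homog {n : ℤ} {w : ℕ} {e : Words α} (he : e ∈ homog α n w) :
    consW none e ∈ homog α (n + 1) w := by
  refine map_mem_of_wordsIn (fun l hl => ?_) he
  rw [consW_word]
  exact word_mem_homog (by simp) (by simp [← hl.2.1]) (by simp [hl.2.2])

theorem consW_some_mem_homog {n : ℤ} {w : ℕ} (x : α) {e : Words α} (he : e ∈ homog α n w) :
    consW (some x) e ∈ homog α (n + 1) (w + 1) := by
  refine map_mem_of_wordsIn (fun l hl => ?_) he
  rw [consW_word]
  exact word_mem_homog (by simp) (by simp [← hl.2.1]) (by simp [hl.2.2])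

theorem mulHead_mem_homog {n : ℤ} {w : ℕ} {e : Words α} (he : e ∈ homog α (n + 1) w) :
    mulHead e ∈ homog α n w := by
  refine map_mem_of_wordsIn (fun l hl => ?_) he
  obtain ⟨_, hn, hw⟩ := hl
  match l, hn, hw with
  | none :: c :: l, hn, hw =>
    rw [mulHead_none]
    exact word_mem_homog (by simp) (by simpa using hn) (by simpa using hw)
  | some x :: none :: l, hn, hw =>
    rw [mulHead_some_none]
    exact word_mem_homog (by simp) (by simpa using hn) (by simpa using hw)
  | some x :: some y :: l, _, _ => rw [mulHead_some_some]; exact zero_mem _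
  | [a], _, _ => rw [mulHead_single]; exact zero_mem _
  | [], _, _ => rw [mulHead_nil]; exact zero_mem _

theorem bar_word_mem_homog (l : List (Option α)) :
    bar (word l) ∈ homog α (l.length - 1) (wordWeight l) := by
  induction l with
  | nil => rw [bar_nil]; exact zero_mem _
  | cons a l ih =>
    rw [bar_cons]
    refine Submodule.sub_mem _ (mulHead_mem_homog (word_mem_homog (by simp) (by simp) rfl)) ?_
    cases a with
    | none =>
      have := consW_none_mem_homog ih
      simpa using this
    | some x =>
      have := consW_some_mem_homog x ih
      simpa using this

theorem bar_mem_homog {n : ℤ} {w : ℕ} {e : Words α} (he : e ∈ homog α (n + 1) w) :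
    bar e ∈ homog α n w :=
  map_mem_of_wordsIn (fun l hl => by
    have := bar_word_mem_homog l
    rwa [hl.2.1, hl.2.2, add_sub_cancel_right] at this) he

theorem hoch_mem_homog {n : ℤ} {w : ℕ} {e : Words α} (he : e ∈ homog α (n + 1) w) :
    hoch e ∈ homog α n w :=
  add_mem (bar_mem_homog he) (mulHead_mem_homog (tW_mem_homog he))

theorem consW_doubleUnit_mem_homog (a : Option α) (l : List (Option α)) :
    consW a (doubleUnit l) ∈ homog α (l.length + 2) (wordWeight (a :: l)) := by
  induction l generalizing a with
  | nil => rw [doubleUnit, map_zero]; exact zero_mem _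
  | cons c l ih =>
    cases c with
    | none =>
      rw [doubleUnit, consW_word]
      refine word_mem_homog (by simp) (by simp; ring) ?_
      cases a <;> simp
    | some x =>
      have h := ih (some x)
      rw [doubleUnit, map_neg]
      refine neg_mem ?_
      cases a with
      | none =>
        convert consW_none_mem_homog h using 2
        · simp; ring
        · simp
      | some y =>
        convert consW_some_mem_homog y h using 2
        · simp; ring
        · simp

theorem homotopy_mem_homog {n : ℤ} {w : ℕ} {e : Words α} (he : e ∈ homog α n w) :
    homotopy e ∈ homog α (n + 1) w := by
  refine map_mem_of_wordsIn (fun l hl => ?_) he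
  obtain ⟨h, hn, hw⟩ := hl
  cases l with
  | nil => exact absurd rfl h
  | cons a l =>
    rw [homotopy_cons]
    convert consW_doubleUnit_mem_homog a l using 2
    · rw [← hn]; simp; ring
    · exact hw.symm

/-- A word without units has as many entries as letters; this and the next lemma decide which
degrees the reduced complex occupies in each column. -/
theorem projQ_eq_zero {n : ℤ} {w : ℕ} {e : Words α} (he : e ∈ homog α n w) (h : n ≠ w) :
    projQ e = 0 := by
  refine eqOn_wordsIn (f := projQ) (g := 0) (fun l hl => ?_) he
  rw [projQ_word, if_neg]
  · rfl
  · rw [← wordWeight_eq_length_iff]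
    have := hl.2.1
    have := hl.2.2
    omega

theorem projP_eq_zero {n : ℤ} {w : ℕ} {e : Words α} (he : e ∈ homog α n w) (h : n ≠ w + 1) :
    projP e = 0 := by
  refine eqOn_wordsIn (f := projP) (g := 0) (fun l hl => ?_) he
  obtain ⟨h0, hn, hw⟩ := hl
  rcases l with _ | ⟨_ | x, l⟩
  · simp
  · rw [projP_none, projQ_word, if_neg]
    · rfl
    · rw [← wordWeight_eq_length_iff]
      simp at hn hw
      omega
  · simp

/-! ### The total complex of words and its acyclic part -/

/-- The vertical differential out of the column numbered `-j`, on words. -/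
def vertW (j : ℕ) : Words α →ₗ[ℤ] Words α := if Even j then hoch else bar

/-- The horizontal differential out of the column numbered `-j`, on words. -/
def horizW (j : ℕ) : Words α →ₗ[ℤ] Words α := if Even j then NW else LinearMap.id - tW

/-- The total differential, on families of words indexed by the columns. -/
def totDW (z : ℕ → Words α) : ℕ → Words α
  | 0 => vertW 0 (z 0)
  | j + 1 => (-1 : ℤ) ^ (j + 1) • vertW (j + 1) (z (j + 1)) + horizW j (z j)

/-- The homotopies of the columns. -/
def colHomotopy (j : ℕ) : Words α →ₗ[ℤ] Words α := if Even j then homotopy else consW none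

theorem vertW_even {j : ℕ} (h : Even j) : vertW (α := α) j = hoch := if_pos h
theorem vertW_odd {j : ℕ} (h : ¬ Even j) : vertW (α := α) j = bar := if_neg h
theorem horizW_even {j : ℕ} (h : Even j) : horizW (α := α) j = NW := if_pos h
theorem horizW_odd {j : ℕ} (h : ¬ Even j) : horizW (α := α) j = LinearMap.id - tW := if_neg h

theorem vertW_horizW (j : ℕ) (e : Words α) :
    vertW (j + 1) (horizW j e) = horizW j (vertW j e) := by
  by_cases h : Even j
  · rw [vertW_odd (by simpa [parity_simps] using h), horizW_even h, vertW_even h, bar_NW]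
  · rw [vertW_even (by simpa [parity_simps] using h), horizW_odd h, vertW_odd h]
    exact hoch_sub_tW e

theorem horizW_horizW (j : ℕ) (e : Words α) : horizW (j + 1) (horizW j e) = 0 := by
  by_cases h : Even j
  · rw [horizW_odd (by simpa [parity_simps] using h), horizW_even h]
    simp [tW_NW]
  · rw [horizW_even (by simpa [parity_simps] using h), horizW_odd h]
    simp [NW_tW]

theorem vertW_mem_homog (j : ℕ) {n : ℤ} {w : ℕ} {e : Words α} (he : e ∈ homog α (n + 1) w) :
    vertW j e ∈ homog α n w := by
  rw [vertW]
  split_ifs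
  exacts [hoch_mem_homog he, bar_mem_homog he]

theorem horizW_mem_homog (j : ℕ) {n : ℤ} {w : ℕ} {e : Words α} (he : e ∈ homog α n w) :
    horizW j e ∈ homog α n w := by
  rw [horizW]
  split_ifs
  exacts [NW_mem_homog he, sub_mem he (tW_mem_homog he)]

theorem colHomotopy_mem_homog (j : ℕ) {n : ℤ} {w : ℕ} {e : Words α} (he : e ∈ homog α n w) :
    colHomotopy j e ∈ homog α (n + 1) w := by
  rw [colHomotopy]
  split_ifs
  exacts [homotopy_mem_homog he, consW_none_mem_homog he]

theorem projQ_colHomotopy (j : ℕ) (e : Words α) : projQ (colHomotopy j e) = 0 := by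
  rw [colHomotopy]
  split_ifs
  exacts [projQ_homotopy e, projQ_consW_none e]

theorem projQ_horizW (j : ℕ) (e : Words α) : projQ (horizW j e) = horizW j (projQ e) := by
  rw [horizW]
  split_ifs
  · exact projQ_NW e
  · simp [projQ_tW]

theorem vertW_colHomotopy {j : ℕ} {e : Words α} (h0 : e [] = 0) (hv : vertW j e = 0)
    (hP : Even j → projP e = 0) (hQ : Even j → projQ e = 0) :
    vertW j (colHomotopy j e) = e := by
  by_cases h : Even j
  · rw [vertW_even h] at hv ⊢
    rw [colHomotopy, if_pos h]
    have := hoch_homotopy e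
    simpa [hv, hP h, hQ h] using this
  · rw [vertW_odd h] at hv ⊢
    rw [colHomotopy, if_neg h, bar_consW_none e h0, hv, map_zero, sub_zero]

/-- Degree `n` and weight `w` in the total complex of words. -/
def IsHomog (n : ℤ) (w : ℕ) (z : ℕ → Words α) : Prop := ∀ j : ℕ, z j ∈ homog α (n + j + 1) w

/-- The acyclic part of the total complex: the common kernel of the projections onto the reduced
complex. -/
structure IsReducible (z : ℕ → Words α) : Prop where
  projQ_even : ∀ j, Even j → projQ (z j) = 0
  projP_zero : projP (z 0) = 0
  projP_add : ∀ j, ¬ Even j → projP (z (j + 1)) + projQ (z j) = 0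

/-- The primitive of a cycle, column by column. -/
def primitive (z : ℕ → Words α) : ℕ → Words α
  | 0 => colHomotopy 0 (z 0)
  | j + 1 => (-1 : ℤ) ^ (j + 1) • colHomotopy (j + 1) (z (j + 1) - horizW j (primitive z j))

/-- The contribution of the preceding column to `z j` dies under the next horizontal map, because
consecutive horizontal maps compose to zero. -/
theorem horizW_vertW_of_totDW {y z : ℕ → Words α} {j : ℕ} (h : totDW y j = z j) :
    horizW j (vertW j (y j)) = (-1 : ℤ) ^ j • horizW j (z j) := by
  rw [← h]
  cases j with
  | zero => simp [totDW]
  | succ j => simp [totDW, horizW_horizW, smul_smul, ← mul_pow]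

theorem projQ_primitive (z : ℕ → Words α) (j : ℕ) : projQ (primitive z j) = 0 := by
  cases j with
  | zero => exact projQ_colHomotopy _ _
  | succ j => rw [primitive, map_smul, projQ_colHomotopy, smul_zero]

theorem projP_primitive (z : ℕ → Words α) {j : ℕ} (hj : Even j) : projP (primitive z j) = 0 := by
  cases j with
  | zero => exact projP_homotopy _
  | succ j => rw [primitive, colHomotopy, if_pos hj, map_smul, projP_homotopy, smul_zero]

theorem primitive_mem_homog {n : ℤ} {w : ℕ} {z : ℕ → Words α} (hz : IsHomog n w z) (j : ℕ) :
    primitive z j ∈ homog α (n + 1 + j + 1) w := by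
  induction j with
  | zero =>
    have := colHomotopy_mem_homog 0 (hz 0)
    simpa [primitive, add_comm, add_left_comm] using this
  | succ j ih =>
    rw [primitive]
    refine Submodule.smul_mem _ _ ?_
    have h := horizW_mem_homog j ih
    have h' := hz (j + 1)
    have e1 : n + 1 + (j : ℤ) + 1 = n + (j + 1 : ℕ) + 1 := by push_cast; ring
    rw [e1] at h
    have := colHomotopy_mem_homog (j + 1) (sub_mem h' h)
    convert this using 2
    push_cast; ring

/-- In each column the part of `z` not yet accounted for by the preceding column is a vertical
cycle, so the column homotopy gives a vertical primitive once the projections of this remainder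
vanish. The second clause is carried along for that: out of an odd column the primitive adds `-projQ
(z j)` to the `projP` of the horizontal image, which the condition `projP_add` cancels. -/
theorem totDW_primitive {n : ℤ} {w : ℕ} {z : ℕ → Words α} (hz : IsHomog n w z)
    (hd : totDW z = 0) (hr : IsReducible z) (j : ℕ) :
    totDW (primitive z) j = z j ∧
      (¬ Even j → projP (horizW j (primitive z j)) = -projQ (z j)) := by
  induction j with
  | zero =>
    refine ⟨vertW_colHomotopy (apply_nil_of_mem_homog (hz 0)) (congrFun hd 0)
      (fun _ => hr.projP_zero) (fun h => hr.projQ_even 0 h), fun h => absurd (by simp) h⟩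
  | succ j ih =>
    obtain ⟨ih1, ih2⟩ := ih
    have hr0 : (z (j + 1) - horizW j (primitive z j)) [] = 0 := by
      have h := horizW_mem_homog j (primitive_mem_homog hz j)
      rw [Finsupp.sub_apply, apply_nil_of_mem_homog (hz (j + 1)), apply_nil_of_mem_homog h,
        sub_zero]
    -- Moving the vertical differential past the horizontal one reduces this to the component of
    -- `totDW z = 0` in column `j + 1`.
    have hv : vertW (j + 1) (z (j + 1) - horizW j (primitive z j)) = 0 := by
      rw [map_sub, vertW_horizW, horizW_vertW_of_totDW ih1]
      have := congrFun hd (j + 1)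
      simp only [totDW, pow_succ, mul_neg, mul_one, neg_smul, Pi.zero_apply] at this
      have h2 := congrArg (fun e => (-1 : ℤ) ^ j • e) this
      simp only [smul_add, smul_neg, smul_smul, ← mul_pow, smul_zero] at h2
      simp only [mul_neg, mul_one, neg_neg, one_pow, one_smul] at h2
      rw [neg_add_eq_zero] at h2
      rw [h2, sub_self]
    have hQ : projQ (z (j + 1) - horizW j (primitive z j)) = projQ (z (j + 1)) := by
      rw [map_sub, projQ_horizW, projQ_primitive, map_zero, sub_zero]
    constructor
    · rw [totDW, primitive, map_smul, smul_smul, ← mul_pow, vertW_colHomotopy hr0 hv]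
      · simp
      · intro h
        have h' : ¬ Even j := by simpa [parity_simps] using h
        rw [map_sub, ih2 h', sub_neg_eq_add, hr.projP_add j h']
      · intro h
        rw [hQ, hr.projQ_even _ h]
    · intro h
      rw [primitive, map_smul, map_smul, colHomotopy, if_neg h, horizW_odd h,
        Odd.neg_one_pow (by simpa using h), LinearMap.sub_apply, LinearMap.id_apply,
        projP_sub_tW_consW_none _ hr0, hQ]
      simp

/-- The acyclic part of the total complex is acyclic. -/
theorem exists_totDW_eq {n : ℤ} {w : ℕ} {z : ℕ → Words α} (hz : IsHomog n w z)
    (hd : totDW z = 0) (hr : IsReducible z) :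
    ∃ y, IsHomog (n + 1) w y ∧ totDW y = z ∧ (∀ j, projQ (y j) = 0) ∧
      ∀ j, Even j → projP (y j) = 0 :=
  ⟨primitive z, primitive_mem_homog hz, funext fun j => (totDW_primitive hz hd hr j).1,
    projQ_primitive z, fun _ h => projP_primitive z h⟩

theorem totDW_sub (y z : ℕ → Words α) : totDW (y - z) = totDW y - totDW z := by
  funext j
  cases j with
  | zero => simp [totDW]
  | succ j =>
    simp only [totDW, Pi.sub_apply, map_sub, smul_sub]
    abel

theorem totDW_add (y z : ℕ → Words α) : totDW (y + z) = totDW y + totDW z :=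
  eq_add_of_sub_eq (by rw [← totDW_sub, add_sub_cancel_right])

theorem IsHomog.add {n : ℤ} {w : ℕ} {y z : ℕ → Words α} (hy : IsHomog n w y)
    (hz : IsHomog n w z) : IsHomog n w (y + z) := fun j => add_mem (hy j) (hz j)

theorem IsHomog.sub {n : ℤ} {w : ℕ} {y z : ℕ → Words α} (hy : IsHomog n w y)
    (hz : IsHomog n w z) : IsHomog n w (y - z) := fun j => sub_mem (hy j) (hz j)

theorem IsHomog.totDW {n : ℤ} {w : ℕ} {y : ℕ → Words α} (hy : IsHomog (n + 1) w y) :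
    IsHomog n w (totDW y) := by
  intro j
  have e : n + 1 + (j : ℤ) + 1 = n + j + 1 + 1 := by ring
  have hj := hy j
  rw [e] at hj
  cases j with
  | zero => exact vertW_mem_homog 0 hj
  | succ j =>
    refine add_mem (Submodule.smul_mem _ _ (vertW_mem_homog _ hj)) (horizW_mem_homog j ?_)
    have := hy j
    convert this using 2
    push_cast; ring

theorem isHomog_single {n : ℤ} {w j : ℕ} {e : Words α} (he : e ∈ homog α (n + j + 1) w) :
    IsHomog n w (Pi.single j e) := by
  intro i
  by_cases h : i = j
  · subst h; simpa
  · rw [Pi.single_eq_of_ne h]; exact zero_mem _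

theorem totDW_single_even {j : ℕ} (hj : Even j) (e : Words α) :
    totDW (Pi.single j e) = Pi.single j (hoch e) + Pi.single (j + 1) (NW e) := by
  have hs : ∀ i, (-1 : ℤ) ^ i • vertW i ((Pi.single j e : ℕ → Words α) i) =
      (Pi.single j (hoch e) : ℕ → Words α) i := by
    intro i
    by_cases h : i = j
    · subst h; simp [vertW_even hj, hj.neg_one_pow]
    · simp [Pi.single_eq_of_ne h]
  funext i
  cases i with
  | zero =>
    have := hs 0
    simp only [pow_zero, one_smul] at this
    simp [totDW, this]
  | succ i =>
    rw [totDW, hs]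
    by_cases h : i = j
    · subst h; simp [horizW_even hj]
    · have h1 : i + 1 ≠ j + 1 := by omega
      simp [Pi.single_eq_of_ne h, Pi.single_eq_of_ne h1]

/-- The square of the total differential is needed only on families in one even column, where the
square of the Hochschild differential vanishes by inspection. -/
theorem totDW_totDW_single_even {j : ℕ} (hj : Even j) {e : Words α} (he : hoch (hoch e) = 0) :
    totDW (totDW (Pi.single j e)) = 0 := by
  have hodd : ¬ Even (j + 1) := by simpa [parity_simps] using hj
  rw [totDW_single_even hj, ← sub_neg_eq_add, totDW_sub, totDW_single_even hj, he]
  funext i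
  cases i with
  | zero =>
    simp [totDW]
  | succ i =>
    by_cases h : i = j
    · subst h
      simp [totDW, vertW_odd hodd, bar_NW, (Nat.not_even_iff_odd.1 hodd).neg_one_pow]
    · by_cases h' : i = j + 1
      · subst h'
        simp [totDW, horizW_odd hodd, tW_NW]
      · have h1 : i + 1 ≠ j + 1 := by omega
        simp [totDW, Pi.single_eq_of_ne h', Pi.single_eq_of_ne h1]

/-! ### The reduced complex with differentials `1 - t` and `N` -/

/-- The projection onto the reduced complex in the degrees with the parity of the weight. -/
def reduceEven : ℕ → (ℕ → Words α) →ₗ[ℤ] Words α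
  | 0 => projP ∘ₗ LinearMap.proj 0
  | k + 1 => projP ∘ₗ LinearMap.proj (2 * k + 2) + projQ ∘ₗ LinearMap.proj (2 * k + 1)

/-- The projection onto the reduced complex in the other degrees. -/
def reduceOdd (k : ℕ) : (ℕ → Words α) →ₗ[ℤ] Words α := projQ ∘ₗ LinearMap.proj (2 * k)

theorem not_even_succ_two_mul (k : ℕ) : ¬ Even (2 * k + 1) := by simp

theorem reduceEven_totDW_zero (y : ℕ → Words α) : reduceEven 0 (totDW y) = 0 := by
  simp [reduceEven, totDW, vertW_even, projP_hoch]

/-- The terms `projP - projP ∘ tW` arise twice, from the vertical map of the odd column and from its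
horizontal map into the next even column, with opposite signs. Only the norm of the even column
before it survives; adding `projQ` of the odd column to `projP` makes this happen. -/
theorem reduceEven_totDW_succ (k : ℕ) (y : ℕ → Words α) :
    reduceEven (k + 1) (totDW y) = NW (reduceOdd k y) := by
  have h1 : Even (2 * k + 1 + 1) := by simp [parity_simps]
  simp only [reduceEven, totDW, reduceOdd, LinearMap.add_apply, LinearMap.comp_apply,
    LinearMap.proj_apply, vertW_even h1, h1.neg_one_pow, horizW_odd (not_even_succ_two_mul k),
    vertW_odd (not_even_succ_two_mul k), horizW_even (even_two_mul k), map_add, map_smul,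
    projP_hoch, projQ_bar, projQ_NW, LinearMap.sub_apply, LinearMap.id_apply, map_sub,
    (Nat.not_even_iff_odd.1 (not_even_succ_two_mul k)).neg_one_pow]
  simp only [smul_zero, zero_add, neg_smul, one_smul]
  abel

theorem reduceOdd_totDW (k : ℕ) (y : ℕ → Words α) :
    reduceOdd k (totDW y) = reduceEven k y - tW (reduceEven k y) := by
  cases k with
  | zero => simp [reduceEven, reduceOdd, totDW, vertW_even, projQ_hoch]
  | succ k =>
    have h1 : Even (2 * k + 1 + 1) := by simp [parity_simps]
    rw [reduceOdd, LinearMap.comp_apply, LinearMap.proj_apply, show 2 * (k + 1) = 2 * k + 1 + 1 by ring]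
    simp only [reduceEven, totDW, LinearMap.add_apply, LinearMap.comp_apply,
      LinearMap.proj_apply, vertW_even h1, h1.neg_one_pow, horizW_odd (not_even_succ_two_mul k),
      map_add, projQ_hoch, LinearMap.sub_apply, LinearMap.id_apply, map_sub, projQ_tW,
      one_smul]
    abel

theorem tW_reduceEven {k : ℕ} {z : ℕ → Words α} (hd : totDW z = 0) :
    tW (reduceEven k z) = reduceEven k z := by
  have := reduceOdd_totDW k z
  rw [hd, map_zero] at this
  exact (sub_eq_zero.1 this.symm).symm

theorem NW_reduceOdd {k : ℕ} {z : ℕ → Words α} (hd : totDW z = 0) :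
    NW (reduceOdd k z) = 0 := by
  have := reduceEven_totDW_succ k z
  rw [hd, map_zero] at this
  exact this.symm

/-- The span of the words of `w` letters, without units. -/
def letters (α : Type) (w : ℕ) : Submodule ℤ (Words α) :=
  wordsIn fun l => l.length = w ∧ l.all Option.isSome

theorem projQ_of_mem_letters {w : ℕ} {c : Words α} (hc : c ∈ letters α w) : projQ c = c :=
  eqOn_wordsIn (f := projQ) (g := LinearMap.id) (fun l hl => by
    rw [projQ_word, if_pos hl.2]; rfl) hc

theorem mem_homog_of_mem_letters {w : ℕ} (hw : 0 < w) {c : Words α} (hc : c ∈ letters α w) :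
    c ∈ homog α w w :=
  map_mem_of_wordsIn (f := LinearMap.id) (fun l hl => word_mem_homog
    (List.length_pos_iff.1 (by omega)) (by simp [hl.1])
    (by rw [← hl.1]; exact (wordWeight_eq_length_iff l).2 hl.2)) hc

theorem consW_none_mem_homog_of_mem_letters {w : ℕ} {c : Words α} (hc : c ∈ letters α w) :
    consW none c ∈ homog α (w + 1) w :=
  map_mem_of_wordsIn (f := consW none) (fun l hl => by
    rw [consW_word]
    refine word_mem_homog (by simp) (by simp [hl.1]) ?_
    rw [wordWeight_none, ← hl.1]
    exact (wordWeight_eq_length_iff l).2 hl.2) hc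

theorem projQ_mem_letters {n : ℤ} {w : ℕ} {e : Words α} (he : e ∈ homog α n w) :
    projQ e ∈ letters α w := by
  refine map_mem_of_wordsIn (fun l hl => ?_) he
  rw [projQ_word]
  split_ifs with h
  · exact word_mem_wordsIn ⟨by rw [← (wordWeight_eq_length_iff l).2 h]; exact hl.2.2, h⟩
  · exact zero_mem _

theorem projP_mem_letters {n : ℤ} {w : ℕ} {e : Words α} (he : e ∈ homog α n w) :
    projP e ∈ letters α w := by
  refine map_mem_of_wordsIn (fun l hl => ?_) he
  obtain ⟨h0, hn, hw⟩ := hl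
  rcases l with _ | ⟨_ | x, l⟩
  · rw [projP_nil]; exact zero_mem _
  · rw [projP_none, projQ_word]
    split_ifs with h
    · rw [wordWeight_none] at hw
      exact word_mem_wordsIn ⟨by rw [← (wordWeight_eq_length_iff l).2 h]; exact hw, h⟩
    · exact zero_mem _
  · rw [projP_some]; exact zero_mem _

theorem reduceEven_mem_letters (k : ℕ) {n : ℤ} {w : ℕ} {z : ℕ → Words α} (hz : IsHomog n w z) :
    reduceEven k z ∈ letters α w := by
  cases k with
  | zero => exact projP_mem_letters (hz 0)
  | succ k => exact add_mem (projP_mem_letters (hz _)) (projQ_mem_letters (hz _))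

theorem reduceOdd_mem_letters (k : ℕ) {n : ℤ} {w : ℕ} {z : ℕ → Words α} (hz : IsHomog n w z) :
    reduceOdd k z ∈ letters α w :=
  projQ_mem_letters (hz _)

/-- In these degrees every word is longer than `w + 1`, so it has a unit away from the head. -/
theorem isReducible_of_gt {n : ℤ} {w : ℕ} (hn : w < n) {z : ℕ → Words α} (hz : IsHomog n w z) :
    IsReducible z where
  projQ_even j _ := projQ_eq_zero (hz j) (by omega)
  projP_zero := projP_eq_zero (hz 0) (by push_cast; omega)
  projP_add j _ := by
    rw [projP_eq_zero (hz (j + 1)) (by push_cast; omega), projQ_eq_zero (hz j) (by omega), add_zero]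

/-- By length, `projP` can be nonzero on an even column only for column `2 * k`, and `projQ` on an
odd column only for column `2 * k - 1`. The map `reduceEven k` is the combination of these two. -/
theorem isReducible_of_reduceEven {w k : ℕ} {z : ℕ → Words α} (hz : IsHomog (w - 2 * k) w z)
    (h : reduceEven k z = 0) : IsReducible z where
  projQ_even j hj := projQ_eq_zero (hz j) (by obtain ⟨i, rfl⟩ := hj; push_cast; omega)
  projP_zero := by
    cases k with
    | zero => exact h
    | succ k => exact projP_eq_zero (hz 0) (by push_cast; omega)
  projP_add j hj := by
    obtain ⟨i, rfl⟩ := Nat.not_even_iff_odd.1 hj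
    by_cases hi : i + 1 = k
    · subst hi; exact h
    · rw [projP_eq_zero (hz _) (by push_cast; omega), projQ_eq_zero (hz _) (by push_cast; omega),
        add_zero]

theorem isReducible_of_reduceOdd {w k : ℕ} {z : ℕ → Words α} (hz : IsHomog (w - 1 - 2 * k) w z)
    (h : reduceOdd k z = 0) : IsReducible z where
  projQ_even j hj := by
    obtain ⟨i, rfl⟩ := hj
    by_cases hi : i = k
    · subst hi
      rw [← two_mul]
      exact h
    · exact projQ_eq_zero (hz _) (by push_cast; omega)
  projP_zero := projP_eq_zero (hz 0) (by push_cast; omega)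
  projP_add j hj := by
    obtain ⟨i, rfl⟩ := Nat.not_even_iff_odd.1 hj
    rw [projP_eq_zero (hz _) (by push_cast; omega), projQ_eq_zero (hz _) (by push_cast; omega),
        add_zero]

theorem exists_totDW_eq_of_reduceEven {w k : ℕ} {z : ℕ → Words α} (hz : IsHomog (w - 2 * k) w z)
    (hd : totDW z = 0) (h : reduceEven k z = 0) :
    ∃ y, IsHomog (w - 2 * k + 1) w y ∧ totDW y = z := by
  obtain ⟨y, hy, hyz, -⟩ := exists_totDW_eq hz hd (isReducible_of_reduceEven hz h)
  exact ⟨y, hy, hyz⟩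

theorem exists_totDW_eq_of_reduceOdd {w k : ℕ} {z : ℕ → Words α}
    (hz : IsHomog (w - 1 - 2 * k) w z) (hd : totDW z = 0) (h : reduceOdd k z = 0) :
    ∃ y, IsHomog (w - 1 - 2 * k + 1) w y ∧ totDW y = z := by
  obtain ⟨y, hy, hyz, -⟩ := exists_totDW_eq hz hd (isReducible_of_reduceOdd hz h)
  exact ⟨y, hy, hyz⟩

/-- The family with `c` alone in column `2 * k` has a boundary whose reduction is `NW c`;
subtracting it leaves a cycle with zero reduction. -/
theorem exists_totDW_eq_of_reduceEven_eq_NW {w k : ℕ} (hw : 0 < w) {z : ℕ → Words α}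
    (hz : IsHomog (w - 2 * (k + 1 : ℕ)) w z) (hd : totDW z = 0) {c : Words α}
    (hc : c ∈ letters α w) (h : reduceEven (k + 1) z = NW c) :
    ∃ y, IsHomog (w - 2 * (k + 1 : ℕ) + 1) w y ∧ totDW y = z := by
  have hy : IsHomog ((w : ℤ) - 2 * (k + 1 : ℕ) + 1) w (Pi.single (2 * k) c) :=
    isHomog_single (by
      convert mem_homog_of_mem_letters hw hc using 2
      push_cast; ring)
  have hc' : hoch c = 0 := by rw [← projQ_of_mem_letters hc, hoch_projQ]
  obtain ⟨y, hy', hyz⟩ := exists_totDW_eq_of_reduceEven (hz.sub hy.totDW)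
    (by rw [totDW_sub, hd, totDW_totDW_single_even (even_two_mul k) (by rw [hc', map_zero]), sub_zero])
    (by rw [map_sub, h, reduceEven_totDW_succ]; simp [reduceOdd, projQ_of_mem_letters hc])
  exact ⟨y + Pi.single (2 * k) c, hy'.add hy, by rw [totDW_add, hyz, sub_add_cancel]⟩

/-- Here the correcting family is `c` with a unit prepended, in column `2 * k`: its boundary reduces
to `c - tW c`. -/
theorem exists_totDW_eq_of_reduceOdd_eq_sub {w k : ℕ} {z : ℕ → Words α}
    (hz : IsHomog (w - 1 - 2 * k) w z) (hd : totDW z = 0) {c : Words α}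
    (hc : c ∈ letters α w) (h : reduceOdd k z = c - tW c) :
    ∃ y, IsHomog (w - 1 - 2 * k + 1) w y ∧ totDW y = z := by
  have hy : IsHomog ((w : ℤ) - 1 - 2 * k + 1) w (Pi.single (2 * k) (consW none c)) :=
    isHomog_single (by
      convert consW_none_mem_homog_of_mem_letters hc using 2
      push_cast; ring)
  have hQ := projQ_of_mem_letters hc
  have hr : reduceEven k (Pi.single (2 * k) (consW none c)) = c := by
    cases k with
    | zero => simp [reduceEven, hQ]
    | succ k =>
      rw [reduceEven, LinearMap.add_apply, LinearMap.comp_apply, LinearMap.comp_apply,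
        LinearMap.proj_apply, LinearMap.proj_apply, show 2 * (k + 1) = 2 * k + 2 by ring,
        Pi.single_eq_same, Pi.single_eq_of_ne (by omega), projP_consW_none, hQ, map_zero, add_zero]
  obtain ⟨y, hy', hyz⟩ := exists_totDW_eq_of_reduceOdd (hz.sub hy.totDW)
    (by
      rw [totDW_sub, hd, totDW_totDW_single_even (even_two_mul k), sub_zero]
      rw [← hQ, hoch_consW_none_projQ, ← projQ_tW, ← map_sub, hoch_projQ])
    (by rw [map_sub, h, reduceOdd_totDW, hr, sub_self])
  exact ⟨y + Pi.single (2 * k) (consW none c), hy'.add hy, by rw [totDW_add, hyz, sub_add_cancel]⟩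

theorem exists_cycle_reduceOdd_eq {w : ℕ} (k : ℕ) (hw : 0 < w) {c : Words α}
    (hc : c ∈ letters α w) (hN : NW c = 0) :
    ∃ z, IsHomog (w - 1 - 2 * k) w z ∧ totDW z = 0 ∧ reduceOdd k z = c := by
  have hc' : hoch c = 0 := by rw [← projQ_of_mem_letters hc, hoch_projQ]
  refine ⟨Pi.single (2 * k) c, isHomog_single ?_, ?_, ?_⟩
  · convert mem_homog_of_mem_letters hw hc using 2
    push_cast; ring
  · rw [totDW_single_even (even_two_mul k), hc', hN]
    simp
  · simp [reduceOdd, projQ_of_mem_letters hc]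

/-- Invariance makes `c` with a unit prepended a vertical cycle, but the norm carries it on to the
next column. This error is itself in the acyclic part, so it bounds a family killed by the
projections in question, and subtracting that family gives a cycle with the same reduction. -/
theorem exists_cycle_reduceEven_eq {w : ℕ} (k : ℕ) {c : Words α}
    (hc : c ∈ letters α w) (ht : tW c = c) :
    ∃ z, IsHomog (w - 2 * k) w z ∧ totDW z = 0 ∧ reduceEven k z = c := by
  have hQ := projQ_of_mem_letters hc
  have hh : hoch (consW none c) = 0 := by
    rw [← hQ, hoch_consW_none_projQ, ← projQ_tW, ht, sub_self]
  have hz : IsHomog ((w : ℤ) - 2 * k) w (Pi.single (2 * k) (consW none c)) :=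
    isHomog_single (by
      convert consW_none_mem_homog_of_mem_letters hc using 2
      push_cast; ring)
  have hr : reduceEven k (Pi.single (2 * k) (consW none c)) = c := by
    cases k with
    | zero => simp [reduceEven, hQ]
    | succ k =>
      rw [reduceEven, LinearMap.add_apply, LinearMap.comp_apply, LinearMap.comp_apply,
        LinearMap.proj_apply, LinearMap.proj_apply, show 2 * (k + 1) = 2 * k + 2 by ring,
        Pi.single_eq_same, Pi.single_eq_of_ne (by omega), projP_consW_none, hQ, map_zero, add_zero]
  have hD := totDW_single_even (even_two_mul k) (consW none c)
  rw [hh, Pi.single_zero, zero_add] at hD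
  have hz' : IsHomog ((w : ℤ) - 2 * k - 1 + 1) w (Pi.single (2 * k) (consW none c)) := by
    rwa [sub_add_cancel]
  have hred : IsReducible (totDW (Pi.single (2 * k) (consW none c))) := by
    rw [hD]
    refine ⟨fun j hj => ?_, ?_, fun j hj => ?_⟩
    · rw [Pi.single_eq_of_ne, map_zero]
      rintro rfl
      exact not_even_succ_two_mul k hj
    · rw [Pi.single_eq_of_ne (by omega), map_zero]
    · have h1 : j + 1 ≠ 2 * k + 1 := fun h =>
        hj (by rw [Nat.succ_injective h]; exact even_two_mul k)
      rw [Pi.single_eq_of_ne h1, map_zero, zero_add]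
      by_cases h : j = 2 * k + 1
      · subst h
        rw [Pi.single_eq_same, projQ_NW, projQ_consW_none, map_zero]
      · rw [Pi.single_eq_of_ne h, map_zero]
  obtain ⟨y, hy, hyz, hyQ, hyP⟩ := exists_totDW_eq hz'.totDW
    (totDW_totDW_single_even (even_two_mul k) (by rw [hh, map_zero])) hred
  rw [sub_add_cancel] at hy
  refine ⟨Pi.single (2 * k) (consW none c) - y, hz.sub hy, ?_, ?_⟩
  · rw [totDW_sub, hyz, sub_self]
  · have : reduceEven k y = 0 := by
      cases k with
      | zero => exact hyP 0 (by simp)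
      | succ k =>
        simp [reduceEven, hyQ, hyP (2 * k + 2) (by simp [parity_simps])]
    rw [map_sub, hr, this, sub_zero]

end Words

/-! ### From tensor powers of the square zero ring to words -/

section Transport

variable {d : ℕ}

theorem mono_none_mul (a : SqZero d) : mono d none * a = a := one_mul a

theorem mul_mono_none (a : SqZero d) : a * mono d none = a := mul_one a

theorem mono_some_mul_mono_some (i j : Fin d) : mono d (some i) * mono d (some j) = 0 := by
  rw [mono, mono, ← map_mul, Ideal.Quotient.eq_zero_iff_mem, sq]
  exact Ideal.mul_mem_mul (Ideal.subset_span ⟨i, rfl⟩) (Ideal.subset_span ⟨j, rfl⟩)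

/-- The linear coordinates of a polynomial, in the trivial square zero extension. -/
def linearPart (d : ℕ) : MvPolynomial (Fin d) ℤ →ₐ[ℤ] TrivSqZeroExt ℤ (Fin d → ℤ) :=
  MvPolynomial.aeval fun i => TrivSqZeroExt.inr (Pi.single i 1)

/-- A product of two variables goes to a product of two elements of square zero type. So the
constant and linear coefficients are defined on the quotient, and they separate the monomials. -/
theorem linearPart_eq_zero (d : ℕ) (p : MvPolynomial (Fin d) ℤ)
    (hp : p ∈ (Ideal.span (Set.range (MvPolynomial.X (R := ℤ) (σ := Fin d)))) ^ 2) :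
    (linearPart d).toRingHom p = 0 := by
  have : (Ideal.span (Set.range (MvPolynomial.X (R := ℤ) (σ := Fin d)))) ^ 2 ≤
      RingHom.ker (linearPart d).toRingHom := by
    rw [sq, Ideal.span_mul_span', Ideal.span_le]
    rintro _ ⟨_, ⟨i, rfl⟩, _, ⟨j, rfl⟩, rfl⟩
    simp [linearPart, RingHom.mem_ker]
  exact this hp

/-- The coordinates on the square zero ring. -/
def sqZeroCoord (d : ℕ) : SqZero d →ₗ[ℤ] (Option (Fin d) → ℤ) :=
  AddMonoidHom.toIntLinearMap
    { toFun := fun x o =>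
        o.elim (Ideal.Quotient.lift _ _ (linearPart_eq_zero d) x).fst
          (Ideal.Quotient.lift _ _ (linearPart_eq_zero d) x).snd
      map_zero' := by ext o; cases o <;> simp
      map_add' := fun x y => by ext o; cases o <;> simp }

theorem sqZeroCoord_mono (o : Option (Fin d)) : sqZeroCoord d (mono d o) = Pi.single o 1 := by
  ext o'
  rcases o with _ | i <;> rcases o' with _ | j <;>
    simp [sqZeroCoord, mono, linearPart, Pi.single_apply]

theorem linearIndependent_mono (d : ℕ) : LinearIndependent ℤ (mono d) := by
  refine LinearIndependent.of_comp (sqZeroCoord d) ?_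
  have : sqZeroCoord d ∘ mono d = Pi.basisFun ℤ (Option (Fin d)) := by
    ext1 o
    rw [Function.comp_apply, sqZeroCoord_mono, Pi.basisFun_apply]
  rw [this]
  exact (Pi.basisFun ℤ _).linearIndependent

theorem span_mono (d : ℕ) : ⊤ ≤ Submodule.span ℤ (Set.range (mono d)) := by
  rintro x -
  obtain ⟨p, rfl⟩ := Ideal.Quotient.mk_surjective x
  induction p using MvPolynomial.induction_on with
  | C a =>
    have : (Ideal.Quotient.mk _ (MvPolynomial.C a) : SqZero d) = a • mono d none := by
      rw [mono, zsmul_one]; simp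
    rw [this]
    exact Submodule.smul_mem _ _ (Submodule.subset_span ⟨none, rfl⟩)
  | add p q hp hq => rw [map_add]; exact add_mem hp hq
  | mul_X p i hp =>
    have key : ∀ x ∈ Submodule.span ℤ (Set.range (mono d)),
        x * mono d (some i) ∈ Submodule.span ℤ (Set.range (mono d)) := by
      intro x hx
      induction hx using Submodule.span_induction with
      | mem x hx =>
        obtain ⟨_ | j, rfl⟩ := hx
        · rw [mono_none_mul]; exact Submodule.subset_span ⟨some i, rfl⟩
        · rw [mono_some_mul_mono_some]; exact zero_mem _
      | zero => rw [zero_mul]; exact zero_mem _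
      | add x y _ _ hx hy => rw [add_mul]; exact add_mem hx hy
      | smul a x _ hx => rw [smul_mul_assoc]; exact Submodule.smul_mem _ _ hx
    rw [map_mul]
    exact key _ hp

/-- The monomial basis of the square zero ring. -/
def monoBasis (d : ℕ) : Module.Basis (Option (Fin d)) ℤ (SqZero d) :=
  Module.Basis.mk (linearIndependent_mono d) (span_mono d)

theorem monoBasis_apply (o : Option (Fin d)) : monoBasis d o = mono d o :=
  Module.Basis.mk_apply _ _ _

/-- The basis of tensor monomials. -/
def chainBasis (d n : ℕ) :
    Module.Basis (Fin (n + 1) → Option (Fin d)) ℤ (Chain ℤ (SqZero d) n) :=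
  Basis.piTensorProduct fun _ => monoBasis d

/-- The tensor monomial of a family of letters and units. -/
def monomial {n : ℕ} (f : Fin (n + 1) → Option (Fin d)) : Chain ℤ (SqZero d) n :=
  PiTensorProduct.tprod ℤ fun i => mono d (f i)

theorem chainBasis_apply {n : ℕ} (f : Fin (n + 1) → Option (Fin d)) :
    chainBasis d n f = monomial f := by
  rw [chainBasis, Basis.piTensorProduct_apply, monomial]
  simp only [monoBasis_apply]

/-- The identification of tensor monomials with words. -/
def toWords (d n : ℕ) : Chain ℤ (SqZero d) n →ₗ[ℤ] Words (Fin d) :=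
  Finsupp.lmapDomain ℤ ℤ List.ofFn ∘ₗ (chainBasis d n).repr.toLinearMap

@[simp] theorem toWords_monomial {n : ℕ} (f : Fin (n + 1) → Option (Fin d)) :
    toWords d n (monomial f) = word (List.ofFn f) := by
  rw [← chainBasis_apply]
  simp [toWords, word, Finsupp.mapDomain_single]

theorem toWords_injective (d n : ℕ) : Function.Injective (toWords d n) :=
  (Finsupp.mapDomain_injective List.ofFn_injective).comp (chainBasis d n).repr.injective

theorem chain_hom_ext {n : ℕ} {M : Type*} [AddCommGroup M]
    {f g : Chain ℤ (SqZero d) n →ₗ[ℤ] M} (h : ∀ a, f (monomial a) = g (monomial a)) : f = g :=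
  (chainBasis d n).ext fun a => by rw [chainBasis_apply, h]

/-- The product of two letters, when one of them is the unit. -/
def mulLetter (a c : Option (Fin d)) : Option (Fin d) := a.elim c some

theorem face_monomial {n : ℕ} (i : Fin (n + 1)) (f : Fin (n + 2) → Option (Fin d)) :
    face ℤ (SqZero d) n i (monomial f) =
      if (f i.castSucc).isSome ∧ (f i.succ).isSome then 0
      else monomial (Fin.contractNth i.castSucc mulLetter f) := by
  rw [face, monomial, PiTensorProduct.lift.tprod]
  change PiTensorProduct.tprod ℤ (Fin.contractNth i.castSucc (· * ·) fun j => mono d (f j)) = _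
  have hi : Fin.contractNth i.castSucc (· * ·) (fun j => mono d (f j)) i =
      mono d (f i.castSucc) * mono d (f i.succ) := by
    simp [Fin.contractNth]
  split_ifs with h
  · refine MultilinearMap.map_coord_zero _ i ?_
    rw [hi]
    obtain ⟨a, ha⟩ := Option.isSome_iff_exists.1 h.1
    obtain ⟨c, hc⟩ := Option.isSome_iff_exists.1 h.2
    rw [ha, hc, mono_some_mul_mono_some]
  · rw [monomial]
    congr 1
    funext l
    by_cases hl : l = i
    · subst hl
      rw [hi]
      have : Fin.contractNth l.castSucc mulLetter f l = mulLetter (f l.castSucc) (f l.succ) := by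
        simp [Fin.contractNth]
      rw [this]
      rcases ha : f l.castSucc with _ | a
      · exact mono_none_mul _
      · rcases hc : f l.succ with _ | c
        · exact mul_mono_none _
        · simp [ha, hc] at h
    · have : (l : ℕ) ≠ i := fun h => hl (Fin.ext h)
      simp only [Fin.contractNth, Fin.val_castSucc]
      split_ifs <;> rfl

theorem ofFn_contractNth {n : ℕ} (i : Fin (n + 1)) (f : Fin (n + 2) → Option (Fin d)) :
    List.ofFn (Fin.contractNth i.castSucc mulLetter f) =
      (List.ofFn f).take i ++
        mulLetter (f i.castSucc) (f i.succ) :: (List.ofFn f).drop (i + 2) := by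
  have hi := i.2
  refine List.ext_getElem (by simp; omega) fun k h1 h2 => ?_
  simp only [List.getElem_ofFn, List.getElem_append, List.getElem_cons, List.length_take,
    List.length_ofFn, List.getElem_take, List.getElem_drop, Fin.contractNth, Fin.val_castSucc]
  have hmin : min (i : ℕ) (n + 1 + 1) = i := by omega
  simp only [hmin]
  rcases lt_trichotomy k (i : ℕ) with h | h | h
  · simp [h, Fin.castSucc]
  · subst h; simp [Fin.castSucc]
  · rw [if_neg (by omega), if_neg (by omega), dif_neg (by omega), dif_neg (by omega)]
    congr 1
    ext
    simp
    omega

theorem drop_ofFn {n : ℕ} (i : Fin (n + 1)) (f : Fin (n + 2) → Option (Fin d)) :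
    (List.ofFn f).drop i = f i.castSucc :: f i.succ :: (List.ofFn f).drop (i + 2) := by
  have hi := i.2
  rw [List.drop_eq_getElem_cons (by rw [List.length_ofFn]; omega),
    List.drop_eq_getElem_cons (by rw [List.length_ofFn]; omega), List.getElem_ofFn,
    List.getElem_ofFn]
  rfl

theorem toWords_face_monomial {n : ℕ} (i : Fin (n + 1)) (f : Fin (n + 2) → Option (Fin d)) :
    toWords d n (face ℤ (SqZero d) n i (monomial f)) =
      prependW ((List.ofFn f).take i) (mulHead (word ((List.ofFn f).drop i))) := by
  rw [face_monomial, drop_ofFn]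
  split_ifs with h
  · obtain ⟨a, ha⟩ := Option.isSome_iff_exists.1 h.1
    obtain ⟨c, hc⟩ := Option.isSome_iff_exists.1 h.2
    simp [ha, hc]
  · rw [toWords_monomial, ofFn_contractNth]
    rcases ha : f i.castSucc with _ | a
    · simp [mulLetter]
    · rcases hc : f i.succ with _ | c
      · simp [mulLetter]
      · simp [ha, hc] at h

theorem toWords_b' (n : ℕ) (c : Chain ℤ (SqZero d) (n + 1)) :
    toWords d n (b' ℤ (SqZero d) n c) = bar (toWords d (n + 1) c) := by
  refine LinearMap.congr_fun (chain_hom_ext (f := toWords d n ∘ₗ b' ℤ (SqZero d) n)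
    (g := bar ∘ₗ toWords d (n + 1)) fun f => ?_) c
  rw [LinearMap.comp_apply, LinearMap.comp_apply, toWords_monomial, bar_eq_sum_prependW, b',
    LinearMap.sum_apply, map_sum, List.length_ofFn, Nat.add_sub_cancel, ← Fin.sum_univ_eq_sum_range
      fun j => (-1 : ℤ) ^ j • prependW ((List.ofFn f).take j) (mulHead (word ((List.ofFn f).drop j)))]
  refine Finset.sum_congr rfl fun i _ => ?_
  rw [LinearMap.smul_apply, map_smul, toWords_face_monomial]

theorem toWords_face_zero (n : ℕ) (c : Chain ℤ (SqZero d) (n + 1)) :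
    toWords d n (face ℤ (SqZero d) n 0 c) = mulHead (toWords d (n + 1) c) := by
  refine LinearMap.congr_fun (chain_hom_ext (f := toWords d n ∘ₗ face ℤ (SqZero d) n 0)
    (g := mulHead ∘ₗ toWords d (n + 1)) fun f => ?_) c
  simp [toWords_face_monomial]

theorem ofFn_finRotate {β : Type} {n : ℕ} (f : Fin (n + 1) → β) :
    List.ofFn (fun i => f ((finRotate (n + 1)).symm i)) = rotList (List.ofFn f) := by
  rw [List.ofFn_succ' f, List.concat_eq_append, rotList_concat, List.ofFn_succ]
  refine congrArg₂ List.cons (congrArg f ?_) (congrArg List.ofFn (funext fun i => congrArg f ?_))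
  · rw [Equiv.symm_apply_eq, finRotate_last]
  · rw [Equiv.symm_apply_eq, finRotate_apply, Fin.coeSucc_eq_succ]

theorem toWords_t (n : ℕ) (c : Chain ℤ (SqZero d) n) :
    toWords d n (t ℤ (SqZero d) n c) = tW (toWords d n c) := by
  refine LinearMap.congr_fun (chain_hom_ext (f := toWords d n ∘ₗ t ℤ (SqZero d) n)
    (g := tW ∘ₗ toWords d n) fun f => ?_) c
  have : rot ℤ (SqZero d) n (monomial f) =
      monomial fun i => f ((finRotate (n + 1)).symm i) := by
    rw [rot, monomial, LinearEquiv.coe_coe, PiTensorProduct.reindex_tprod]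
    rfl
  rw [LinearMap.comp_apply, LinearMap.comp_apply, t, LinearMap.smul_apply, this, map_smul,
    toWords_monomial, toWords_monomial, ofFn_finRotate, tW, extend_word, List.length_ofFn,
    Nat.add_sub_cancel]

theorem toWords_mem_ofLength (n : ℕ) (c : Chain ℤ (SqZero d) n) :
    toWords d n c ∈ ofLength (Fin d) (n + 1) := by
  have : (⊤ : Submodule ℤ (Chain ℤ (SqZero d) n)) ≤
      (ofLength (Fin d) (n + 1)).comap (toWords d n) := by
    rw [← (chainBasis d n).span_eq, Submodule.span_le]
    rintro _ ⟨f, rfl⟩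
    rw [SetLike.mem_coe, Submodule.mem_comap, chainBasis_apply, toWords_monomial]
    exact word_mem_wordsIn (by simp)
  exact this (Submodule.mem_top (x := c))

theorem toWords_N (n : ℕ) (c : Chain ℤ (SqZero d) n) :
    toWords d n (N ℤ (SqZero d) n c) = NW (toWords d n c) := by
  have h : ∀ i, toWords d n ((t ℤ (SqZero d) n ^ i) c) = (tW ^ i) (toWords d n c) := by
    intro i
    induction i with
    | zero => simp
    | succ i ih =>
      have h := LinearMap.congr_fun (pow_succ' (t ℤ (SqZero d) n) i) c
      rw [h, pow_succ' tW, Module.End.mul_apply, Module.End.mul_apply, toWords_t, ih]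
  rw [NW_of_length (toWords_mem_ofLength n c), N, LinearMap.sum_apply, map_sum]
  exact Finset.sum_congr rfl fun i _ => h i

theorem toWords_b (n : ℕ) (c : Chain ℤ (SqZero d) (n + 1)) :
    toWords d n (b ℤ (SqZero d) n c) = hoch (toWords d (n + 1) c) := by
  rw [b, hoch, LinearMap.add_apply, LinearMap.add_apply, map_add, toWords_b', LinearMap.comp_apply,
    ← toWords_t, ← toWords_face_zero, LinearMap.smul_apply, lastFace, LinearMap.comp_apply, t,
    LinearMap.smul_apply, map_smul (face ℤ (SqZero d) n 0)]

theorem toWords_vert (j n : ℕ) (c : Chain ℤ (SqZero d) (n + 1)) :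
    toWords d n (vert ℤ (SqZero d) j n c) = vertW j (toWords d (n + 1) c) := by
  rw [vert, vertW]
  split_ifs
  exacts [toWords_b n c, toWords_b' n c]

theorem toWords_horiz (j n : ℕ) (c : Chain ℤ (SqZero d) n) :
    toWords d n (horiz ℤ (SqZero d) j n c) = horizW j (toWords d n c) := by
  rw [horiz, horizW]
  split_ifs
  · exact toWords_N n c
  · simp [toWords_t]

theorem card_filter_isSome : ∀ {n : ℕ} (f : Fin n → Option (Fin d)),
    (Finset.univ.filter fun i => (f i).isSome).card = wordWeight (List.ofFn f)
  | 0, f => by simp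
  | n + 1, f => by
    rw [Fin.card_filter_univ_succ, List.ofFn_succ, card_filter_isSome fun i => f i.succ]
    cases h : f 0 <;> simp

theorem map_weightPart (w n : ℕ) :
    (weightPart d w n).map (toWords d n) = homog (Fin d) (n + 1) w := by
  rw [weightPart, Submodule.map_span, homog, wordsIn]
  congr 1
  ext e
  constructor
  · rintro ⟨_, ⟨f, hf, rfl⟩, rfl⟩
    refine ⟨List.ofFn f, ⟨by simp [List.ofFn_succ], by simp, ?_⟩, toWords_monomial f⟩
    rw [← card_filter_isSome]
    exact hf
  · rintro ⟨l, ⟨-, hn, hw⟩, rfl⟩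
    have hn' : l.length = n + 1 := by exact_mod_cast hn
    have hl : List.ofFn (fun i : Fin (n + 1) => l[i]) = l :=
      List.ext_getElem (by rw [List.length_ofFn, hn']) fun k h1 h2 => List.getElem_ofFn h1
    refine ⟨_, ⟨fun i => l[i], ?_, rfl⟩, ?_⟩
    · rw [weight, card_filter_isSome, hl, hw]
    · exact (toWords_monomial _).trans (by rw [hl])

/-! ### The total complex as families of words -/

/-- The identification of the total complex with families of words. -/
def totToWords (d : ℕ) (n : ℤ) : Tot ℤ (SqZero d) n →ₗ[ℤ] (ℕ → Words (Fin d)) :=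
  LinearMap.pi fun j =>
    if h : 0 ≤ n + j then
      toWords d (n + j).toNat ∘ₗ
        LinearMap.proj (φ := fun p : {p : ℕ × ℕ // (p.2 : ℤ) - (p.1 : ℤ) = n} =>
          Chain ℤ (SqZero d) p.1.2) ⟨(j, (n + j).toNat), by simp [h]⟩
    else 0

theorem totToWords_apply {n : ℤ} (z : Tot ℤ (SqZero d) n) {j q : ℕ} (h : (q : ℤ) - j = n) :
    totToWords d n z j = toWords d q (z ⟨(j, q), h⟩) := by
  have hq : q = (n + j).toNat := by omega
  subst hq
  have h0 : 0 ≤ n + j := by omega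
  simp [totToWords, h0]

theorem totToWords_of_neg {n : ℤ} (z : Tot ℤ (SqZero d) n) {j : ℕ} (h : n + j < 0) :
    totToWords d n z j = 0 := by
  simp [totToWords, h.not_ge]

theorem totToWords_injective (d : ℕ) (n : ℤ) : Function.Injective (totToWords d n) := by
  intro z z' h
  funext p
  obtain ⟨⟨j, q⟩, hp⟩ := p
  have := congrFun h j
  rw [totToWords_apply z hp, totToWords_apply z' hp] at this
  exact toWords_injective d q this

/-- The formula for `totDW` does not know that rows are nonnegative; this says that nothing leaves
row zero vertically. -/
theorem vertW_of_mem_ofLength_one (j : ℕ) {e : Words (Fin d)} (he : e ∈ ofLength (Fin d) 1) :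
    vertW j e = 0 := by
  refine eqOn_wordsIn (f := vertW j) (g := 0) (fun l hl => ?_) he
  obtain ⟨a, rfl⟩ := List.length_eq_one_iff.1 hl
  rw [vertW]
  split_ifs <;> simp [hoch, tW_single]

theorem totToWords_totD {n m : ℤ} (h : m + 1 = n) (z : Tot ℤ (SqZero d) n) :
    totToWords d m (totD ℤ (SqZero d) n m h z) = totDW (totToWords d n z) := by
  funext j
  by_cases hj : 0 ≤ m + j
  · obtain ⟨q, hq⟩ := Int.eq_ofNat_of_zero_le hj
    have hp : (q : ℤ) - j = m := by omega
    rw [totToWords_apply _ hp]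
    cases j with
    | zero =>
      have h1 : ((q + 1 : ℕ) : ℤ) - (0 : ℕ) = n := by push_cast at *; omega
      rw [totDW, totToWords_apply z h1, ← toWords_vert]
      rfl
    | succ j =>
      have h1 : ((q + 1 : ℕ) : ℤ) - (j + 1 : ℕ) = n := by push_cast at *; omega
      have h2 : (q : ℤ) - j = n := by push_cast at *; omega
      rw [totDW, totToWords_apply z h1, totToWords_apply z h2, ← toWords_vert, ← toWords_horiz,
        ← map_smul, ← map_add]
      rfl
  · have hv : vertW j (totToWords d n z j) = 0 := by
      by_cases hj' : 0 ≤ n + j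
      · have h1 : ((0 : ℕ) : ℤ) - j = n := by push_cast; omega
        rw [totToWords_apply z h1]
        exact vertW_of_mem_ofLength_one j (toWords_mem_ofLength 0 _)
      · rw [totToWords_of_neg z (by omega), map_zero]
    rw [totToWords_of_neg _ (by omega)]
    cases j with
    | zero => rw [totDW, hv]
    | succ j =>
      rw [totDW, hv, smul_zero, zero_add, totToWords_of_neg z (by push_cast at *; omega), map_zero]

theorem isHomog_totToWords {w : ℕ} {n : ℤ} {z : Tot ℤ (SqZero d) n} (hz : z ∈ totWeight d w n) :
    IsHomog n w (totToWords d n z) := by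
  intro j
  by_cases hj : 0 ≤ n + j
  · obtain ⟨q, hq⟩ := Int.eq_ofNat_of_zero_le hj
    have hp : (q : ℤ) - j = n := by omega
    rw [totToWords_apply z hp, hq, ← map_weightPart]
    exact Submodule.mem_map_of_mem (hz ⟨(j, q), hp⟩ (Set.mem_univ _))
  · rw [totToWords_of_neg z (by omega)]
    exact zero_mem _

/-- The row of a column is determined by the degree. Columns that would need a negative row carry
zero, since homogeneous elements exclude the empty word. -/
theorem exists_totToWords_eq {w : ℕ} {n : ℤ} {y : ℕ → Words (Fin d)} (hy : IsHomog n w y) :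
    ∃ z ∈ totWeight d w n, totToWords d n z = y := by
  have h : ∀ p : {p : ℕ × ℕ // (p.2 : ℤ) - (p.1 : ℤ) = n}, ∃ c ∈ weightPart d w p.1.2,
      toWords d p.1.2 c = y p.1.1 := by
    rintro ⟨⟨j, q⟩, hp⟩
    have h1 := hy j
    have h2 : n + j = q := by simp at hp; omega
    rw [h2, ← map_weightPart] at h1
    exact h1
  choose z hz hzy using h
  refine ⟨z, fun p _ => hz p, ?_⟩
  funext j
  by_cases hj : 0 ≤ n + j
  · obtain ⟨q, hq⟩ := Int.eq_ofNat_of_zero_le hj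
    have hp : (q : ℤ) - j = n := by omega
    rw [totToWords_apply z hp]
    exact hzy ⟨(j, q), hp⟩
  · rw [totToWords_of_neg z (by omega)]
    exact (eq_zero_of_mem_homog (hy j) (by omega)).symm

theorem mem_cycles_iff {w : ℕ} {n : ℤ} {z : Tot ℤ (SqZero d) n} :
    z ∈ cycles d w n ↔ z ∈ totWeight d w n ∧ totDW (totToWords d n z) = 0 := by
  rw [cycles, Submodule.mem_inf, LinearMap.mem_ker, ← totToWords_totD (m := n - 1) (by omega),
    map_eq_zero_iff _ (totToWords_injective d (n - 1))]

theorem mem_boundaries_iff {w : ℕ} {n : ℤ} {z : Tot ℤ (SqZero d) n} :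
    z ∈ boundaries d w n ↔ ∃ y, IsHomog (n + 1) w y ∧ totDW y = totToWords d n z := by
  constructor
  · rintro ⟨y, hy, rfl⟩
    exact ⟨_, isHomog_totToWords hy, (totToWords_totD rfl y).symm⟩
  · rintro ⟨_, hy, hyz⟩
    obtain ⟨y, hy', rfl⟩ := exists_totToWords_eq hy
    refine ⟨y, hy', totToWords_injective d n ?_⟩
    rw [totToWords_totD, hyz]

end Transport

/-! ### Twisted functions on a set with a cyclic action -/

section CyclicReps

variable {X I : Type}

/-- Representatives of the orbits of a map `τ` with `τ ^ w = 1`, with the lengths of the orbits. -/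
structure CyclicReps (τ : X → X) (w : ℕ) (I : Type) where
  /-- The length of an orbit. -/
  len : I → ℕ
  /-- The representative of an orbit. -/
  rep : I → X
  len_pos : ∀ o, 0 < len o
  len_dvd : ∀ o, len o ∣ w
  iterate_len : ∀ o, τ^[len o] (rep o) = rep o
  bijective : Function.Bijective fun p : (o : I) × Fin (len o) => τ^[p.2] (rep p.1)

namespace CyclicReps

variable {τ : X → X} {w : ℕ} (R : CyclicReps τ w I)

theorem exists_fun (g : I → ℕ → ℤ) :
    ∃ f : X → ℤ, ∀ o i, i < R.len o → f (τ^[i] (R.rep o)) = g o i := by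
  refine ⟨fun x => g ((Equiv.ofBijective _ R.bijective).symm x).1
    ((Equiv.ofBijective _ R.bijective).symm x).2, fun o i hi => ?_⟩
  have : (Equiv.ofBijective _ R.bijective).symm (τ^[i] (R.rep o)) = ⟨o, ⟨i, hi⟩⟩ := by
    rw [Equiv.symm_apply_eq]; rfl
  exact congrArg (fun p : (o : I) × Fin (R.len o) => g p.1 p.2) this

theorem exists_eq (x : X) : ∃ o i, i < R.len o ∧ τ^[i] (R.rep o) = x := by
  obtain ⟨⟨o, i⟩, h⟩ := R.bijective.2 x
  exact ⟨o, i, i.2, h⟩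

theorem iterate_period (R : CyclicReps τ w I) (x : X) : τ^[w] x = x := by
  obtain ⟨o, i, -, rfl⟩ := R.exists_eq x
  obtain ⟨k, hk⟩ := R.len_dvd o
  have h : Function.IsPeriodicPt τ (R.len o * k) (R.rep o) :=
    Function.IsPeriodicPt.mul_const (R.iterate_len o) k
  rw [← hk] at h
  rw [← Function.iterate_add_apply, add_comm, Function.iterate_add_apply]
  exact congrArg _ h

end CyclicReps

/-- The operator `f ↦ ε f ∘ τ`. -/
def twist (τ : X → X) (ε : ℤ) : (X → ℤ) →ₗ[ℤ] (X → ℤ) := ε • LinearMap.funLeft ℤ ℤ τ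

theorem twist_apply (τ : X → X) (ε : ℤ) (f : X → ℤ) (x : X) : twist τ ε f x = ε * f (τ x) := rfl

theorem twist_pow_apply (τ : X → X) (ε : ℤ) (i : ℕ) (f : X → ℤ) (x : X) :
    (twist τ ε ^ i) f x = ε ^ i * f (τ^[i] x) := by
  induction i generalizing x with
  | zero => simp
  | succ i ih =>
    rw [pow_succ', Module.End.mul_apply, twist_apply, ih, Function.iterate_succ_apply, pow_succ']
    ring

/-- The norm `1 + T + ⋯ + T ^ (w - 1)` of `T = twist τ ε`. -/
def twistNorm (τ : X → X) (ε : ℤ) (w : ℕ) : (X → ℤ) →ₗ[ℤ] (X → ℤ) :=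
  ∑ i ∈ Finset.range w, twist τ ε ^ i

theorem twistNorm_apply (τ : X → X) (ε : ℤ) (w : ℕ) (f : X → ℤ) (x : X) :
    twistNorm τ ε w f x = ∑ i ∈ Finset.range w, ε ^ i * f (τ^[i] x) := by
  simp [twistNorm, LinearMap.sum_apply, Finset.sum_apply, twist_pow_apply]

namespace CyclicReps

variable {τ : X → X} {w : ℕ} (R : CyclicReps τ w I) {ε : ℤ}

/-- The alternating sum of a function over an orbit. -/
def orbitSum (ε : ℤ) (o : I) : (X → ℤ) →ₗ[ℤ] ℤ :=
  ∑ i ∈ Finset.range (R.len o), ε ^ i • LinearMap.proj (τ^[i] (R.rep o))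

theorem orbitSum_apply (o : I) (f : X → ℤ) :
    R.orbitSum ε o f = ∑ i ∈ Finset.range (R.len o), ε ^ i * f (τ^[i] (R.rep o)) := by
  simp [orbitSum, LinearMap.sum_apply]

theorem apply_iterate_of_twist_eq {f : X → ℤ} (hε : ε * ε = 1) (hf : twist τ ε f = f) (i : ℕ)
    (x : X) : f (τ^[i] x) = ε ^ i * f x := by
  have h : (twist τ ε ^ i) f = f := by
    induction i with
    | zero => rfl
    | succ i ih => rw [pow_succ, Module.End.mul_apply, hf, ih]
  have h' := congrFun h x
  rw [twist_pow_apply] at h'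
  rw [← h', ← mul_assoc, ← mul_pow, hε, one_pow, one_mul]

/-- An invariant function is determined by its values at representatives. Going once around an orbit
of sign `-1` gives `f = -f` there. -/
theorem eq_zero_of_twist_eq {f : X → ℤ} (hε : ε * ε = 1) (hf : twist τ ε f = f)
    (h : ∀ o, ε ^ R.len o = 1 → f (R.rep o) = 0) : f = 0 := by
  funext x
  obtain ⟨o, i, -, rfl⟩ := R.exists_eq x
  rw [apply_iterate_of_twist_eq hε hf]
  by_cases ho : ε ^ R.len o = 1
  · rw [h o ho, mul_zero]; rfl
  · have h1 : ε ^ R.len o * ε ^ R.len o = 1 := by rw [← mul_pow, hε, one_pow]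
    have h2 := (mul_self_eq_one_iff.1 h1).resolve_left ho
    have h3 := apply_iterate_of_twist_eq hε hf (R.len o) (R.rep o)
    rw [R.iterate_len, h2] at h3
    have : f (R.rep o) = 0 := by omega
    rw [this, mul_zero]; rfl

theorem exists_twist_eq (hε : ε * ε = 1) (a : I → ℤ) (ha : ∀ o, ε ^ R.len o * a o = a o) :
    ∃ f, twist τ ε f = f ∧ ∀ o, f (R.rep o) = a o := by
  obtain ⟨f, hf⟩ := R.exists_fun fun o i => ε ^ i * a o
  have h0 : ∀ o, f (R.rep o) = a o := fun o => by simpa using hf o 0 (R.len_pos o)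
  refine ⟨f, ?_, h0⟩
  funext x
  obtain ⟨o, i, hi, rfl⟩ := R.exists_eq x
  rw [twist_apply, ← Function.iterate_succ_apply' τ, hf o i hi]
  have h1 : f (τ^[i + 1] (R.rep o)) = ε ^ (i + 1) * a o := by
    rcases Nat.lt_or_ge (i + 1) (R.len o) with h | h
    · exact hf o _ h
    · have : i + 1 = R.len o := by omega
      rw [this, R.iterate_len, h0, ha]
  rw [h1, pow_succ', ← mul_assoc, ← mul_assoc, hε, one_mul]

/-- The `w` iterates run `w / R.len o` times around the orbit, each time with the same signs. -/
theorem twistNorm_rep {o : I} (ho : ε ^ R.len o = 1) (f : X → ℤ) :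
    twistNorm τ ε w f (R.rep o) = (w / R.len o : ℕ) * R.orbitSum ε o f := by
  obtain ⟨q, hq⟩ := R.len_dvd o
  have key : ∀ q, ∑ i ∈ Finset.range (R.len o * q), ε ^ i * f (τ^[i] (R.rep o)) =
      q * R.orbitSum ε o f := by
    intro q
    induction q with
    | zero => simp
    | succ q ih =>
      rw [Nat.mul_succ, Finset.sum_range_add, ih, orbitSum_apply]
      push_cast
      rw [add_mul, one_mul]
      congr 1
      refine Finset.sum_congr rfl fun i _ => ?_
      rw [pow_add, pow_mul, ho, one_pow, one_mul, add_comm, Function.iterate_add_apply,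
        Function.IsPeriodicPt.mul_const (R.iterate_len o) q]
  have h := key q
  rw [← hq] at h
  rw [twistNorm_apply, h, Nat.div_eq_of_eq_mul_right (R.len_pos o) hq]

theorem twist_twistNorm (R : CyclicReps τ w I) (hw : ε ^ w = 1) (f : X → ℤ) :
    twist τ ε (twistNorm τ ε w f) = twistNorm τ ε w f := by
  have hT : (twist τ ε ^ w) f = f := by
    funext x
    rw [twist_pow_apply, hw, one_mul, R.iterate_period]
  have h := Finset.sum_range_succ' (fun i => (twist τ ε ^ i) f) w
  rw [Finset.sum_range_succ, hT, pow_zero, Module.End.one_apply] at h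
  rw [twistNorm, LinearMap.sum_apply, map_sum, add_right_cancel h]
  exact Finset.sum_congr rfl fun i _ => by rw [pow_succ', Module.End.mul_apply]

theorem exists_orbitSum_eq (ε : ℤ) (a : I → ℤ) : ∃ f, ∀ o, R.orbitSum ε o f = a o := by
  obtain ⟨f, hf⟩ := R.exists_fun fun o i => if i = 0 then a o else 0
  refine ⟨f, fun o => ?_⟩
  rw [orbitSum_apply, Finset.sum_eq_single_of_mem 0 (Finset.mem_range.2 (R.len_pos o))]
  · rw [hf o 0 (R.len_pos o)]; simp
  · intro i hi h
    rw [hf o i (Finset.mem_range.1 hi), if_neg h, mul_zero]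

/-- Both `f` and any norm are invariant, so it suffices to match them at representatives of orbits
of sign `1`, where the norm is a multiple of a freely prescribable orbit sum. -/
theorem exists_twistNorm_eq (hε : ε * ε = 1) (hw : ε ^ w = 1) {f : X → ℤ}
    (hf : twist τ ε f = f)
    (h : ∀ o, ε ^ R.len o = 1 → ((w / R.len o : ℕ) : ℤ) ∣ f (R.rep o)) :
    ∃ g, twistNorm τ ε w g = f := by
  obtain ⟨g, hg⟩ := R.exists_orbitSum_eq ε fun o => f (R.rep o) / (w / R.len o : ℕ)
  refine ⟨g, sub_eq_zero.1 (R.eq_zero_of_twist_eq hε ?_ fun o ho => ?_)⟩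
  · rw [map_sub, R.twist_twistNorm hw, hf]
  · rw [Pi.sub_apply, R.twistNorm_rep ho, hg, Int.mul_ediv_cancel' (h o ho), sub_self]

theorem twistNorm_eq_zero_iff (hw0 : 0 < w) (hε : ε * ε = 1) (hw : ε ^ w = 1) (f : X → ℤ) :
    twistNorm τ ε w f = 0 ↔ ∀ o, ε ^ R.len o = 1 → R.orbitSum ε o f = 0 := by
  constructor
  · intro h o ho
    have h1 := R.twistNorm_rep ho f
    rw [h, Pi.zero_apply] at h1
    refine (mul_eq_zero.1 h1.symm).resolve_left ?_
    have := Nat.div_pos (Nat.le_of_dvd hw0 (R.len_dvd o)) (R.len_pos o)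
    omega
  · intro h
    refine R.eq_zero_of_twist_eq hε (R.twist_twistNorm hw f) fun o ho => ?_
    rw [R.twistNorm_rep ho, h o ho, mul_zero]

/-- The sum telescopes around the orbit. The factor is `0` or `2` according to the sign of the
orbit, the source of the `ℤ/2`. -/
theorem orbitSum_sub_twist (o : I) (f : X → ℤ) :
    R.orbitSum ε o (f - twist τ ε f) = (1 - ε ^ R.len o) * f (R.rep o) := by
  rw [orbitSum_apply]
  have h : ∀ i, ε ^ i * (f - twist τ ε f) (τ^[i] (R.rep o)) =
      ε ^ i * f (τ^[i] (R.rep o)) - ε ^ (i + 1) * f (τ^[i + 1] (R.rep o)) := by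
    intro i
    rw [Pi.sub_apply, twist_apply, Function.iterate_succ_apply', pow_succ]
    ring
  rw [Finset.sum_congr rfl fun i _ => h i, Finset.sum_range_sub', R.iterate_len]
  simp only [pow_zero, Function.iterate_zero, id_eq]
  ring

/-- The equation is solved recursively along the orbit from the initial value `a o`; the hypothesis
on the orbit sum is the condition for the recursion to close up. -/
theorem exists_sub_twist_eq (hε : ε * ε = 1) {f : X → ℤ} (a : I → ℤ)
    (ha : ∀ o, R.orbitSum ε o f = (1 - ε ^ R.len o) * a o) :
    ∃ g, g - twist τ ε g = f := by
  obtain ⟨g, hg⟩ := R.exists_fun fun o i =>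
    ε ^ i * (a o - ∑ k ∈ Finset.range i, ε ^ k * f (τ^[k] (R.rep o)))
  have hg' : ∀ o i, i ≤ R.len o → g (τ^[i] (R.rep o)) =
      ε ^ i * (a o - ∑ k ∈ Finset.range i, ε ^ k * f (τ^[k] (R.rep o))) := by
    intro o i hi
    rcases hi.lt_or_eq with h | rfl
    · exact hg o i h
    · have h0 : g (R.rep o) = a o := by simpa using hg o 0 (R.len_pos o)
      have h1 : ε ^ R.len o * ε ^ R.len o = 1 := by rw [← mul_pow, hε, one_pow]
      rw [R.iterate_len, h0, ← orbitSum_apply, ha]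
      linear_combination (-a o) * h1
  refine ⟨g, funext fun x => ?_⟩
  obtain ⟨o, i, hi, rfl⟩ := R.exists_eq x
  rw [Pi.sub_apply, twist_apply, ← Function.iterate_succ_apply' τ, hg' o i hi.le, hg' o (i + 1) hi,
    Finset.sum_range_succ, pow_succ']
  have h1 : ε ^ i * ε ^ i = 1 := by rw [← mul_pow, hε, one_pow]
  linear_combination (-(ε ^ i * (a o - ∑ k ∈ Finset.range i, ε ^ k * f (τ^[k] (R.rep o)) -
    ε ^ i * f (τ^[i] (R.rep o))))) * hε + f (τ^[i] (R.rep o)) * h1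

end CyclicReps

end CyclicReps

/-! ### Orbits of words under rotation and their number -/

section CyclicWords

variable {d w m : ℕ}

/-- The rotation of a word that moves the first letter to the end. -/
def rotLeft (v : Fin w → Fin d) : Fin w → Fin d := fun i => v (finRotate w i)

theorem rotWord_rotLeft (v : Fin w → Fin d) : rotWord (rotLeft v) = v := by
  funext i; simp only [rotWord, rotLeft, Equiv.apply_symm_apply]

theorem rotLeft_rotWord (v : Fin w → Fin d) : rotLeft (rotWord v) = v := by
  funext i; simp only [rotWord, rotLeft, Equiv.symm_apply_apply]

theorem rotWord_iterate_eq_iff (n : ℕ) (u v : Fin w → Fin d) :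
    rotWord^[n] u = v ↔ u = rotLeft^[n] v :=
  ⟨fun h => by rw [← h]; exact ((show Function.LeftInverse rotLeft rotWord from
      rotLeft_rotWord).iterate n u).symm,
    fun h => by rw [h]; exact (show Function.LeftInverse rotWord rotLeft from
      rotWord_rotLeft).iterate n v⟩

/-- A rotation and its inverse have the same periods; `rotLeft` is the one that becomes the shift of
sequences. -/
theorem cycleLength_eq (v : Fin w → Fin d) :
    cycleLength v = Function.minimalPeriod rotLeft v := by
  refine Function.minimalPeriod_eq_minimalPeriod_iff.2 fun n => ?_
  rw [Function.IsPeriodicPt, Function.IsFixedPt, rotWord_iterate_eq_iff]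
  exact eq_comm

/-- The shift of a sequence. -/
def shift (a : ℕ → Fin d) : ℕ → Fin d := fun k => a (k + 1)

theorem shift_iterate (n : ℕ) (a : ℕ → Fin d) : shift^[n] a = fun k => a (k + n) := by
  induction n generalizing a with
  | zero => rfl
  | succ n ih => rw [Function.iterate_succ_apply, ih]; funext k; rw [shift]; congr 1

theorem isPeriodicPt_shift_iff {n : ℕ} {a : ℕ → Fin d} :
    Function.IsPeriodicPt shift n a ↔ Function.Periodic a n := by
  rw [Function.IsPeriodicPt, Function.IsFixedPt, shift_iterate, funext_iff]
  rfl

/-- The periodic sequence of a word. -/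
def toSeq (hw : 0 < w) (v : Fin w → Fin d) : ℕ → Fin d := fun k => v ⟨k % w, Nat.mod_lt _ hw⟩

/-- The word of the first letters of a sequence. -/
def ofSeq (w : ℕ) (a : ℕ → Fin d) : Fin w → Fin d := fun i => a i

theorem toSeq_periodic (hw : 0 < w) (v : Fin w → Fin d) : Function.Periodic (toSeq hw v) w :=
  fun k => by simp [toSeq]

theorem ofSeq_toSeq (hw : 0 < w) (v : Fin w → Fin d) : ofSeq w (toSeq hw v) = v := by
  funext i
  simp [ofSeq, toSeq, Nat.mod_eq_of_lt i.2]

theorem toSeq_ofSeq (hw : 0 < w) {a : ℕ → Fin d} (ha : Function.Periodic a w) :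
    toSeq hw (ofSeq w a) = a :=
  funext fun k => ha.map_mod_nat k

theorem toSeq_injective (hw : 0 < w) : Function.Injective (toSeq (d := d) hw) :=
  (show Function.LeftInverse (ofSeq w) (toSeq hw) from ofSeq_toSeq hw).injective

theorem toSeq_rotLeft (hw : 0 < w) (v : Fin w → Fin d) :
    toSeq hw (rotLeft v) = shift (toSeq hw v) := by
  funext k
  obtain ⟨w, rfl⟩ := Nat.exists_eq_succ_of_ne_zero hw.ne'
  rw [toSeq, rotLeft, shift, toSeq]
  congr 1
  rw [finRotate_apply]
  ext
  simp [Fin.val_add]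

theorem toSeq_rotLeft_iterate (hw : 0 < w) (n : ℕ) (v : Fin w → Fin d) :
    toSeq hw (rotLeft^[n] v) = shift^[n] (toSeq hw v) :=
  (show Function.Semiconj (toSeq hw) rotLeft shift from toSeq_rotLeft hw).iterate_right n v

theorem isPeriodicPt_rotLeft_iff (hw : 0 < w) {n : ℕ} {v : Fin w → Fin d} :
    Function.IsPeriodicPt rotLeft n v ↔ Function.Periodic (toSeq hw v) n := by
  rw [← isPeriodicPt_shift_iff, Function.IsPeriodicPt, Function.IsFixedPt,
    ← (toSeq_injective hw).eq_iff, toSeq_rotLeft_iterate]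
  rfl

theorem isPeriodicPt_rotLeft (v : Fin w → Fin d) : Function.IsPeriodicPt rotLeft w v := by
  rcases Nat.eq_zero_or_pos w with rfl | hw
  · rfl
  · exact (isPeriodicPt_rotLeft_iff hw).2 (toSeq_periodic hw v)

theorem minimalPeriod_eq_of_toSeq_eq (hw : 0 < w) (hm : 0 < m) {v : Fin w → Fin d}
    {u : Fin m → Fin d} (h : toSeq hw v = toSeq hm u) :
    Function.minimalPeriod rotLeft v = Function.minimalPeriod rotLeft u :=
  Function.minimalPeriod_eq_minimalPeriod_iff.2 fun n => by
    rw [isPeriodicPt_rotLeft_iff hw, isPeriodicPt_rotLeft_iff hm, h]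

theorem mem_cycleFamily_iff {u v : Fin w → Fin d} :
    u ∈ cycleFamily v ↔ ∃ n, u = rotLeft^[n] v := by
  -- The inverse of a rotation is its power `w - 1`; for `w = 0` there is only one word.
  have h : ∀ n, ∀ x : Fin w → Fin d, rotLeft^[n] (rotLeft^[n * (w - 1)] x) = x := fun n x => by
    rcases Nat.eq_zero_or_pos w with rfl | hw
    · exact Subsingleton.elim _ _
    · rw [← Function.iterate_add_apply, show n + n * (w - 1) = w * n by
        obtain ⟨w, rfl⟩ := Nat.exists_eq_succ_of_ne_zero hw.ne'
        simp; ring]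
      exact (isPeriodicPt_rotLeft x).mul_const n
  constructor
  · rintro ⟨n, rfl⟩
    exact ⟨n * (w - 1), (rotWord_iterate_eq_iff n _ _).2 (h n v).symm⟩
  · rintro ⟨n, rfl⟩
    refine ⟨n * (w - 1), ((rotWord_iterate_eq_iff _ _ _).2 ?_).symm⟩
    rw [← Function.iterate_add_apply, add_comm, Function.iterate_add_apply, h]

theorem mem_cycleFamily_self (v : Fin w → Fin d) : v ∈ cycleFamily v := ⟨0, rfl⟩

theorem cycleFamily_rotLeft_iterate (n : ℕ) (v : Fin w → Fin d) :
    cycleFamily (rotLeft^[n] v) = cycleFamily v := by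
  ext u
  constructor
  · intro h
    obtain ⟨k, rfl⟩ := mem_cycleFamily_iff.1 h
    exact mem_cycleFamily_iff.2 ⟨k + n, (Function.iterate_add_apply _ _ _ _).symm⟩
  · rintro ⟨k, rfl⟩
    refine ⟨k + n, ?_⟩
    rw [Function.iterate_add_apply, (rotWord_iterate_eq_iff n _ v).2 rfl]

/-- A representative of a cycle family. -/
def familyRep (S : omega m d) : Fin m → Fin d := S.2.choose

theorem minimalPeriod_familyRep (S : omega m d) :
    Function.minimalPeriod rotLeft (familyRep S) = m := by
  rw [← cycleLength_eq]; exact S.2.choose_spec.1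

theorem cycleFamily_familyRep (S : omega m d) : cycleFamily (familyRep S) = S :=
  S.2.choose_spec.2.symm

theorem periodic_of_dvd {a : ℕ → Fin d} (ha : Function.Periodic a m) (h : m ∣ w) :
    Function.Periodic a w := by
  obtain ⟨k, rfl⟩ := h
  rw [← isPeriodicPt_shift_iff] at ha ⊢
  exact ha.mul_const k

/-- The words of length `w` are the rotations of the repetitions of the representatives of the
cycle families, for the divisors of `w`. -/
def cyclicReps (d : ℕ) (hw : 0 < w) :
    CyclicReps (rotLeft (w := w) (d := d)) w ((m : {m : ℕ // m ∣ w}) × omega m.1 d) :=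
  have hpos : ∀ m : {m : ℕ // m ∣ w}, 0 < m.1 := fun m => Nat.pos_of_dvd_of_pos m.2 hw
  have hseq : ∀ o : (m : {m : ℕ // m ∣ w}) × omega m.1 d,
      toSeq hw (ofSeq w (toSeq (hpos o.1) (familyRep o.2))) =
        toSeq (hpos o.1) (familyRep o.2) := fun o =>
    toSeq_ofSeq hw (periodic_of_dvd (toSeq_periodic _ _) o.1.2)
  have hmin : ∀ o : (m : {m : ℕ // m ∣ w}) × omega m.1 d,
      Function.minimalPeriod rotLeft (ofSeq w (toSeq (hpos o.1) (familyRep o.2))) = o.1.1 :=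
    fun o => (minimalPeriod_eq_of_toSeq_eq hw (hpos o.1) (hseq o)).trans
      (minimalPeriod_familyRep o.2)
  { len := fun o => o.1.1
    rep := fun o => ofSeq w (toSeq (hpos o.1) (familyRep o.2))
    len_pos := fun o => hpos o.1
    len_dvd := fun o => o.1.2
    iterate_len := fun o => by
      have h := Function.isPeriodicPt_minimalPeriod rotLeft
        (ofSeq w (toSeq (hpos o.1) (familyRep o.2)))
      rwa [hmin] at h
    bijective := by
      constructor
      · rintro ⟨o, i⟩ ⟨o', j⟩ h
        have hp : o.1.1 = o'.1.1 := by
          have h1 := congrArg (Function.minimalPeriod rotLeft) h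
          dsimp only at h1
          rw [Function.minimalPeriod_apply_iterate
              ((Function.mem_periodicPts).2 ⟨w, hw, isPeriodicPt_rotLeft _⟩),
            Function.minimalPeriod_apply_iterate
              ((Function.mem_periodicPts).2 ⟨w, hw, isPeriodicPt_rotLeft _⟩), hmin, hmin] at h1
          exact h1
        obtain ⟨⟨m, hm⟩, S⟩ := o
        obtain ⟨⟨m', hm'⟩, S'⟩ := o'
        obtain rfl : m = m' := hp
        -- A word and its repetition define the same periodic sequence, so the equality descends to
        -- the primitive words.
        have h2 : rotLeft^[(i : ℕ)] (familyRep S) = rotLeft^[(j : ℕ)] (familyRep S') := by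
          refine toSeq_injective (hpos ⟨m, hm⟩) ?_
          have h3 := congrArg (toSeq hw) h
          dsimp only at h3
          rw [toSeq_rotLeft_iterate, toSeq_rotLeft_iterate, hseq ⟨⟨m, hm⟩, S⟩,
            hseq ⟨⟨m, hm⟩, S'⟩] at h3
          rw [toSeq_rotLeft_iterate, toSeq_rotLeft_iterate]
          exact h3
        have hS : S = S' := by
          refine Subtype.ext ?_
          rw [← cycleFamily_familyRep S, ← cycleFamily_familyRep S',
            ← cycleFamily_rotLeft_iterate i, h2, cycleFamily_rotLeft_iterate]
        subst hS
        have hij : (i : ℕ) = j := by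
          refine Function.iterate_injOn_Iio_minimalPeriod (f := rotLeft) (x := familyRep S) ?_ ?_ h2
          · rw [minimalPeriod_familyRep]; exact i.2
          · rw [minimalPeriod_familyRep]; exact j.2
        rw [Fin.ext hij]
      · intro v
        -- The primitive root of `v` consists of its first `m` letters; it is a rotation of the
        -- chosen representative of its family, and the exponent matters only modulo `m`.
        set m := Function.minimalPeriod rotLeft v with hm
        have hmw : m ∣ w := (isPeriodicPt_rotLeft v).minimalPeriod_dvd
        have hm0 := hpos ⟨m, hmw⟩
        have hv : toSeq hm0 (ofSeq m (toSeq hw v)) = toSeq hw v :=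
          toSeq_ofSeq hm0 ((isPeriodicPt_rotLeft_iff hw).1
            (Function.isPeriodicPt_minimalPeriod rotLeft v))
        have hS : cycleFamily (ofSeq m (toSeq hw v)) ∈ omega m d :=
          ⟨_, by rw [cycleLength_eq, ← minimalPeriod_eq_of_toSeq_eq hw hm0 hv.symm], rfl⟩
        have h1 : ofSeq m (toSeq hw v) ∈ cycleFamily (familyRep ⟨_, hS⟩) := by
          rw [cycleFamily_familyRep]
          exact mem_cycleFamily_self _
        obtain ⟨n, hn⟩ := mem_cycleFamily_iff.1 h1
        refine ⟨⟨⟨⟨m, hmw⟩, ⟨_, hS⟩⟩, ⟨n % m, Nat.mod_lt _ hm0⟩⟩, toSeq_injective hw ?_⟩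
        dsimp only
        rw [toSeq_rotLeft_iterate, hseq ⟨⟨m, hmw⟩, ⟨_, hS⟩⟩, ← toSeq_rotLeft_iterate,
          (isPeriodicPt_rotLeft _).iterate_mod_apply n]
        exact (congrArg (toSeq hm0) hn).symm.trans hv }

/-- Count the words of length `w` by their orbits: a family of primitive words of length `m ∣ w`
accounts for `m` of them. -/
theorem sum_mul_ncard_omega (d : ℕ) (hw : 0 < w) :
    ∑ m ∈ w.divisors, m * (omega m d).ncard = d ^ w := by
  have h := Nat.card_congr (Equiv.ofBijective _ (cyclicReps d hw).bijective)
  have : ∀ m : {m : ℕ // m ∣ w}, Finite (omega m.1 d) := fun m => Set.toFinite _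
  have : Fintype {m : ℕ // m ∣ w} := Fintype.subtype w.divisors fun m => by simp [hw.ne']
  have : ∀ m : {m : ℕ // m ∣ w}, Fintype (omega m.1 d) := fun m => Fintype.ofFinite _
  rw [Nat.card_eq_fintype_card, Nat.card_eq_fintype_card, Fintype.card_sigma,
    Fintype.sum_sigma] at h
  simp only [Fintype.card_fun, Fintype.card_fin] at h
  rw [← h, Finset.sum_subtype w.divisors (p := fun m => m ∣ w) fun m => by simp [hw.ne']]
  refine Finset.sum_congr rfl fun m _ => ?_
  rw [← Nat.card_coe_set_eq, Nat.card_eq_fintype_card, mul_comm]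
  change _ = ∑ _S : omega m.1 d, m.1
  simp

theorem ncard_omega (d : ℕ) (hm : 0 < m) : ((omega m d).ncard : ℚ) =
    1 / (m : ℚ) * ∑ i ∈ m.divisors, (ArithmeticFunction.moebius (m / i) : ℚ) * (d : ℚ) ^ i := by
  have h := (ArithmeticFunction.sum_eq_iff_sum_mul_moebius_eq
    (f := fun m => (m : ℚ) * ((omega m d).ncard : ℚ)) (g := fun m => (d : ℚ) ^ m)).1
    (fun n hn => by exact_mod_cast sum_mul_ncard_omega d hn) m hm
  rw [Nat.sum_divisorsAntidiagonal' (f := fun i j => (ArithmeticFunction.moebius i : ℚ) * (d : ℚ) ^ j)] at h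
  rw [h]
  have : (m : ℚ) ≠ 0 := by exact_mod_cast hm.ne'
  field_simp

end CyclicWords

/-! ### Comparison with signed functions on words, and the homology -/

section Main

variable {d w : ℕ}

/-- The word without units of a family of letters. -/
def letterWord (v : Fin w → Fin d) : List (Option (Fin d)) := (List.ofFn v).map some

theorem letterWord_injective : Function.Injective (letterWord (w := w) (d := d)) :=
  (List.map_injective_iff.2 (Option.some_injective _)).comp List.ofFn_injective

theorem letterWord_spec (v : Fin w → Fin d) :
    (letterWord v).length = w ∧ (letterWord v).all Option.isSome := by
  simp [letterWord]

theorem exists_letterWord_eq {l : List (Option (Fin d))} (hl : l.length = w)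
    (h : l.all Option.isSome) : ∃ v : Fin w → Fin d, letterWord v = l := by
  subst hl
  rw [List.all_eq_true] at h
  refine ⟨fun i => (l[i]).get (h _ (List.getElem_mem _)), List.ext_getElem ?_ fun k h1 h2 => ?_⟩
  · simp [letterWord]
  · simp only [letterWord, List.getElem_map, List.getElem_ofFn]
    exact Option.some_get _

theorem rotList_letterWord (v : Fin w → Fin d) : rotList (letterWord v) = letterWord (rotWord v) := by
  rw [letterWord, letterWord, rotList, List.length_map, ← List.map_rotate]
  congr 1
  change rotList _ = _
  cases w with
  | zero => exact (List.length_eq_zero_iff.1 (by simp)).trans (List.length_eq_zero_iff.1 (by simp)).symm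
  | succ w => exact (ofFn_finRotate v).symm

/-- A function on the families of letters, as a combination of words. -/
def ofLetters (d w : ℕ) : ((Fin w → Fin d) → ℤ) →ₗ[ℤ] Words (Fin d) :=
  ∑ v, LinearMap.smulRight (LinearMap.proj v) (word (letterWord v))

theorem ofLetters_apply (f : (Fin w → Fin d) → ℤ) :
    ofLetters d w f = ∑ v, f v • word (letterWord v) := by
  simp [ofLetters, LinearMap.sum_apply]

/-- The coefficients of the words without units. -/
def toLetters (d w : ℕ) : Words (Fin d) →ₗ[ℤ] ((Fin w → Fin d) → ℤ) :=
  LinearMap.pi fun v => Finsupp.lapply (letterWord v)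

theorem toLetters_ofLetters (f : (Fin w → Fin d) → ℤ) : toLetters d w (ofLetters d w f) = f := by
  funext v
  rw [ofLetters_apply, toLetters, LinearMap.pi_apply, Finsupp.lapply_apply, Finsupp.finsetSum_apply,
    Finset.sum_eq_single v]
  · simp [word]
  · intro u _ hu
    simp [word, letterWord_injective.ne hu]
  · simp

theorem ofLetters_toLetters {e : Words (Fin d)} (he : e ∈ letters (Fin d) w) :
    ofLetters d w (toLetters d w e) = e := by
  refine eqOn_wordsIn (f := ofLetters d w ∘ₗ toLetters d w) (g := LinearMap.id) (fun l hl => ?_) he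
  obtain ⟨v, rfl⟩ := exists_letterWord_eq hl.1 hl.2
  rw [LinearMap.comp_apply, LinearMap.id_apply, ofLetters_apply, Finset.sum_eq_single v]
  · simp [toLetters, word]
  · intro u _ hu
    simp [toLetters, word, letterWord_injective.ne hu.symm]
  · simp

theorem ofLetters_mem (f : (Fin w → Fin d) → ℤ) : ofLetters d w f ∈ letters (Fin d) w := by
  rw [ofLetters_apply]
  exact sum_mem fun v _ => Submodule.smul_mem _ _ (word_mem_wordsIn (letterWord_spec v))

/-- The sign of the rotation of `w` tensor factors. -/
abbrev rotSign (w : ℕ) : ℤ := (-1) ^ (w - 1)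

/-- Pushing the words forward by `rotWord` pulls the coefficients back along its inverse `rotLeft`.
-/
theorem tW_ofLetters (f : (Fin w → Fin d) → ℤ) :
    tW (ofLetters d w f) = ofLetters d w (twist rotLeft (rotSign w) f) := by
  rw [ofLetters_apply, ofLetters_apply, map_sum]
  let σ : Equiv.Perm (Fin w → Fin d) := ⟨rotWord, rotLeft, rotLeft_rotWord, rotWord_rotLeft⟩
  refine Fintype.sum_equiv σ _ _ fun v => ?_
  rw [map_smul, tW, extend_word, rotList_letterWord, (letterWord_spec v).1, twist_apply]
  change _ = (rotSign w * f (rotLeft (rotWord v))) • word (letterWord (rotWord v))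
  rw [rotLeft_rotWord, smul_smul, mul_comm]

theorem NW_ofLetters (f : (Fin w → Fin d) → ℤ) :
    NW (ofLetters d w f) = ofLetters d w (twistNorm rotLeft (rotSign w) w f) := by
  have h : ∀ i, (tW ^ i) (ofLetters d w f) = ofLetters d w ((twist rotLeft (rotSign w) ^ i) f) := by
    intro i
    induction i with
    | zero => rfl
    | succ i ih => rw [pow_succ', Module.End.mul_apply, ih, tW_ofLetters, pow_succ',
        Module.End.mul_apply]
  have hmem : ofLetters d w f ∈ ofLength (Fin d) w :=
    map_mem_of_wordsIn (f := LinearMap.id) (fun l hl => word_mem_wordsIn hl.1) (ofLetters_mem f)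
  rw [NW_of_length hmem, twistNorm, LinearMap.sum_apply, map_sum]
  exact Finset.sum_congr rfl fun i _ => h i

theorem toLetters_tW {e : Words (Fin d)} (he : e ∈ letters (Fin d) w) :
    toLetters d w (tW e) = twist rotLeft (rotSign w) (toLetters d w e) := by
  conv_lhs => rw [← ofLetters_toLetters he, tW_ofLetters, toLetters_ofLetters]

theorem toLetters_NW {e : Words (Fin d)} (he : e ∈ letters (Fin d) w) :
    toLetters d w (NW e) = twistNorm rotLeft (rotSign w) w (toLetters d w e) := by
  conv_lhs => rw [← ofLetters_toLetters he, NW_ofLetters, toLetters_ofLetters]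

/-- The projection to the reduced complex in the degrees `w - 2 k`. -/
def evenMap (d w k : ℕ) (n : ℤ) : Tot ℤ (SqZero d) n →ₗ[ℤ] ((Fin w → Fin d) → ℤ) :=
  toLetters d w ∘ₗ reduceEven k ∘ₗ totToWords d n

/-- The projection to the reduced complex in the degrees `w - 1 - 2 k`. -/
def oddMap (d w k : ℕ) (n : ℤ) : Tot ℤ (SqZero d) n →ₗ[ℤ] ((Fin w → Fin d) → ℤ) :=
  toLetters d w ∘ₗ reduceOdd k ∘ₗ totToWords d n

theorem twist_evenMap (k : ℕ) {n : ℤ} {z : Tot ℤ (SqZero d) n} (hz : z ∈ cycles d w n) :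
    twist rotLeft (rotSign w) (evenMap d w k n z) = evenMap d w k n z := by
  rw [mem_cycles_iff] at hz
  have h := reduceEven_mem_letters k (isHomog_totToWords hz.1)
  rw [evenMap, LinearMap.comp_apply, LinearMap.comp_apply, ← toLetters_tW h, tW_reduceEven hz.2]

theorem twistNorm_oddMap (k : ℕ) {n : ℤ} {z : Tot ℤ (SqZero d) n} (hz : z ∈ cycles d w n) :
    twistNorm rotLeft (rotSign w) w (oddMap d w k n z) = 0 := by
  rw [mem_cycles_iff] at hz
  have h := reduceOdd_mem_letters k (isHomog_totToWords hz.1)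
  rw [oddMap, LinearMap.comp_apply, LinearMap.comp_apply, ← toLetters_NW h, NW_reduceOdd hz.2,
    map_zero]

theorem exists_evenMap_eq (k : ℕ) {n : ℤ} (hn : n = w - 2 * k) {f : (Fin w → Fin d) → ℤ}
    (hf : twist rotLeft (rotSign w) f = f) : ∃ z ∈ cycles d w n, evenMap d w k n z = f := by
  subst hn
  obtain ⟨y, hy, hd, hr⟩ := exists_cycle_reduceEven_eq k (ofLetters_mem f)
    (by rw [tW_ofLetters, hf])
  obtain ⟨z, hz, rfl⟩ := exists_totToWords_eq hy
  refine ⟨z, mem_cycles_iff.2 ⟨hz, hd⟩, ?_⟩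
  rw [evenMap, LinearMap.comp_apply, LinearMap.comp_apply, hr, toLetters_ofLetters]

theorem exists_oddMap_eq (k : ℕ) {n : ℤ} (hw : 0 < w) (hn : n = w - 1 - 2 * k)
    {f : (Fin w → Fin d) → ℤ} (hf : twistNorm rotLeft (rotSign w) w f = 0) :
    ∃ z ∈ cycles d w n, oddMap d w k n z = f := by
  subst hn
  obtain ⟨y, hy, hd, hr⟩ := exists_cycle_reduceOdd_eq k hw (ofLetters_mem f)
    (by rw [NW_ofLetters, hf, map_zero])
  obtain ⟨z, hz, rfl⟩ := exists_totToWords_eq hy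
  refine ⟨z, mem_cycles_iff.2 ⟨hz, hd⟩, ?_⟩
  rw [oddMap, LinearMap.comp_apply, LinearMap.comp_apply, hr, toLetters_ofLetters]

theorem mem_boundaries_of_evenMap_eq_zero (k : ℕ) {n : ℤ} (hn : n = w - 2 * k)
    {z : Tot ℤ (SqZero d) n} (hz : z ∈ cycles d w n) (h : evenMap d w k n z = 0) :
    z ∈ boundaries d w n := by
  subst hn
  rw [mem_cycles_iff] at hz
  rw [mem_boundaries_iff]
  refine exists_totDW_eq_of_reduceEven (isHomog_totToWords hz.1) hz.2 ?_
  rw [← ofLetters_toLetters (reduceEven_mem_letters k (isHomog_totToWords hz.1))]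
  exact (congrArg _ h).trans (map_zero _)

theorem evenMap_zero_of_mem_boundaries {n : ℤ} {z : Tot ℤ (SqZero d) n}
    (hz : z ∈ boundaries d w n) : evenMap d w 0 n z = 0 := by
  obtain ⟨y, -, hyz⟩ := mem_boundaries_iff.1 hz
  rw [evenMap, LinearMap.comp_apply, LinearMap.comp_apply, ← hyz, reduceEven_totDW_zero, map_zero]

theorem evenMap_succ_of_mem_boundaries (k : ℕ) {n : ℤ} {z : Tot ℤ (SqZero d) n}
    (hz : z ∈ boundaries d w n) :
    ∃ y, IsHomog (n + 1) w y ∧ evenMap d w (k + 1) n z =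
      twistNorm rotLeft (rotSign w) w (toLetters d w (reduceOdd k y)) := by
  obtain ⟨y, hy, hyz⟩ := mem_boundaries_iff.1 hz
  refine ⟨y, hy, ?_⟩
  rw [evenMap, LinearMap.comp_apply, LinearMap.comp_apply, ← hyz, reduceEven_totDW_succ,
    toLetters_NW (reduceOdd_mem_letters k hy)]

theorem mem_boundaries_iff_evenMap_zero {z : Tot ℤ (SqZero d) w} (hz : z ∈ cycles d w w) :
    z ∈ boundaries d w w ↔ evenMap d w 0 w z = 0 :=
  ⟨evenMap_zero_of_mem_boundaries, mem_boundaries_of_evenMap_eq_zero 0 (by simp) hz⟩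

theorem mem_boundaries_iff_evenMap_succ (k : ℕ) {n : ℤ} (hw : 0 < w)
    (hn : n = w - 2 * (k + 1 : ℕ)) {z : Tot ℤ (SqZero d) n} (hz : z ∈ cycles d w n) :
    z ∈ boundaries d w n ↔ ∃ g, twistNorm rotLeft (rotSign w) w g = evenMap d w (k + 1) n z := by
  constructor
  · intro h
    obtain ⟨y, -, hy⟩ := evenMap_succ_of_mem_boundaries k h
    exact ⟨_, hy.symm⟩
  · rintro ⟨g, hg⟩
    subst hn
    rw [mem_cycles_iff] at hz
    rw [mem_boundaries_iff]
    refine exists_totDW_eq_of_reduceEven_eq_NW hw (isHomog_totToWords hz.1) hz.2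
      (ofLetters_mem g) ?_
    rw [NW_ofLetters, hg]
    exact (ofLetters_toLetters (reduceEven_mem_letters (k + 1) (isHomog_totToWords hz.1))).symm

theorem mem_boundaries_iff_oddMap (k : ℕ) {n : ℤ} (hn : n = w - 1 - 2 * k)
    {z : Tot ℤ (SqZero d) n} (hz : z ∈ cycles d w n) :
    z ∈ boundaries d w n ↔ ∃ g, g - twist rotLeft (rotSign w) g = oddMap d w k n z := by
  constructor
  · intro h
    obtain ⟨y, hy, hyz⟩ := mem_boundaries_iff.1 h
    refine ⟨toLetters d w (reduceEven k y), ?_⟩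
    rw [oddMap, LinearMap.comp_apply, LinearMap.comp_apply, ← hyz, reduceOdd_totDW, map_sub,
      toLetters_tW (reduceEven_mem_letters k hy)]
  · rintro ⟨g, hg⟩
    subst hn
    rw [mem_cycles_iff] at hz
    rw [mem_boundaries_iff]
    refine exists_totDW_eq_of_reduceOdd_eq_sub (isHomog_totToWords hz.1) hz.2 (ofLetters_mem g) ?_
    rw [tW_ofLetters, ← map_sub, hg]
    exact (ofLetters_toLetters (reduceOdd_mem_letters k (isHomog_totToWords hz.1))).symm

theorem subsingleton_HCneg {n : ℤ} (h : ∀ z ∈ cycles d w n, z ∈ boundaries d w n) :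
    Subsingleton (HCneg d w n) :=
  Submodule.Quotient.subsingleton_iff.2
    ((Submodule.submoduleOf_eq_top).2 h)

theorem subsingleton_HCneg_of_gt {n : ℤ} (hn : (w : ℤ) < n) : Subsingleton (HCneg d w n) := by
  refine subsingleton_HCneg fun z hz => ?_
  rw [mem_cycles_iff] at hz
  have hh := isHomog_totToWords hz.1
  obtain ⟨y, hy, hyz, -⟩ := exists_totDW_eq hh hz.2 (isReducible_of_gt hn hh)
  exact mem_boundaries_iff.2 ⟨y, hy, hyz⟩

/-- All nonzero cases go through this first isomorphism theorem, so the map is needed only on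
cycles. -/
theorem nonempty_HCneg_equiv {n : ℤ} {M : Type*} [AddCommGroup M] (Φ : Tot ℤ (SqZero d) n →ₗ[ℤ] M)
    (hs : ∀ a, ∃ z ∈ cycles d w n, Φ z = a)
    (hk : ∀ z ∈ cycles d w n, z ∈ boundaries d w n ↔ Φ z = 0) :
    Nonempty (HCneg d w n ≃ₗ[ℤ] M) := by
  have hsurj : Function.Surjective (Φ.domRestrict (cycles d w n)) := fun a => by
    obtain ⟨z, hz, h⟩ := hs a
    exact ⟨⟨z, hz⟩, h⟩
  have hker : (boundaries d w n).submoduleOf (cycles d w n) =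
      LinearMap.ker (Φ.domRestrict (cycles d w n)) := by
    ext z
    exact hk z.1 z.2
  exact ⟨(Submodule.quotEquivOfEq _ _ hker).trans
    ((Φ.domRestrict (cycles d w n)).quotKerEquivOfSurjective hsurj)⟩

theorem nonempty_HCneg_zero_equiv {n : ℤ} (k : ℕ) (hn : n = -(2 * k)) :
    Nonempty (HCneg d 0 n ≃ₗ[ℤ] ℤ) := by
  have hn' : n = (0 : ℕ) - 2 * k := by rw [hn]; simp
  refine nonempty_HCneg_equiv (LinearMap.proj default ∘ₗ evenMap d 0 k n) (fun a => ?_)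
    fun z hz => ?_
  · have hf : twist rotLeft (rotSign 0) (fun _ : Fin 0 → Fin d => a) = fun _ => a := by
      funext x; simp [twist_apply]
    obtain ⟨z, hz, h⟩ := exists_evenMap_eq k hn' hf
    exact ⟨z, hz, congrFun h default⟩
  · constructor
    · intro h
      cases k with
      | zero => exact congrFun (evenMap_zero_of_mem_boundaries h) default
      | succ k =>
        obtain ⟨y, hy, hyz⟩ := evenMap_succ_of_mem_boundaries k h
        -- In weight zero this component would consist of empty words, so the norm contributes no
        -- boundaries.
        have : reduceOdd k y = 0 := by
          rw [reduceOdd, LinearMap.comp_apply, LinearMap.proj_apply,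
            eq_zero_of_mem_homog (hy (2 * k)) (by rw [hn]; push_cast; linarith), map_zero]
        rw [this, map_zero, map_zero] at hyz
        exact congrFun hyz default
    · intro h
      refine mem_boundaries_of_evenMap_eq_zero k hn' hz (funext fun x => ?_)
      rw [Subsingleton.elim x default]
      exact h

theorem subsingleton_HCneg_zero {n : ℤ} (hn : ¬ (Even n ∧ n ≤ 0)) :
    Subsingleton (HCneg d 0 n) := by
  by_cases h : 0 < n
  · exact subsingleton_HCneg_of_gt (by simpa using h)
  · have ho : Odd n := Int.not_even_iff_odd.1 fun he => hn ⟨he, by omega⟩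
    obtain ⟨k, hk⟩ : ∃ k : ℕ, n = ((0 : ℕ) : ℤ) - 1 - 2 * k := by
      obtain ⟨j, rfl⟩ := ho
      exact ⟨(-j - 1).toNat, by push_cast; omega⟩
    refine subsingleton_HCneg fun z hz => (mem_boundaries_iff_oddMap k hk hz).2 ⟨0, ?_⟩
    rw [mem_cycles_iff] at hz
    have := isHomog_totToWords hz.1 (2 * k)
    rw [oddMap, LinearMap.comp_apply, LinearMap.comp_apply, reduceOdd, LinearMap.comp_apply,
      LinearMap.proj_apply, eq_zero_of_mem_homog this (by rw [hk]; push_cast; linarith)]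
    simp

theorem rotSign_mul_self (w : ℕ) : rotSign w * rotSign w = 1 := by
  rw [rotSign, ← mul_pow]; simp

/-- The sign is `(-1) ^ ((w - 1) * m)`. For odd `w` it is `1`, and the divisor `m` is odd too; for
even `w` it is `1` exactly when `m` is even. -/
theorem rotSign_pow_eq_one_iff {m : ℕ} (hw : 0 < w) (hm : m ∣ w) :
    rotSign w ^ m = 1 ↔ m ≡ w [MOD 2] := by
  rw [rotSign, ← pow_mul, neg_one_pow_eq_one_iff_even (by norm_num), Nat.even_mul]
  obtain ⟨w, rfl⟩ := Nat.exists_eq_succ_of_ne_zero hw.ne'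
  have h1 : Even m → Even (w + 1) := fun h => h.trans_dvd hm
  rw [Nat.succ_sub_one, Nat.ModEq]
  rw [Nat.even_add_one] at h1
  rw [Nat.even_iff, Nat.even_iff] at *
  omega

theorem rotSign_pow_self (hw : 0 < w) : rotSign w ^ w = 1 :=
  (rotSign_pow_eq_one_iff hw dvd_rfl).2 rfl

theorem rotSign_pow_eq_neg_one {m : ℕ} (hw : 0 < w) (hm : m ∣ w) (h : ¬ m ≡ w [MOD 2]) :
    rotSign w ^ m = -1 := by
  rw [← rotSign_pow_eq_one_iff hw hm] at h
  exact (mul_self_eq_one_iff.1 (by rw [← mul_pow, rotSign_mul_self, one_pow])).resolve_left h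

/-- A nested finite direct sum is the product. -/
theorem nonempty_directSum_equiv {p : ℕ → Prop} [Finite {m // p m}] (M : {m // p m} → Type)
    [∀ m, AddCommGroup (M m)] :
    Nonempty (((m : {m // p m}) → omega m.1 d → M m) ≃ₗ[ℤ]
      ⨁ m : {m // p m}, ⨁ _ : omega m.1 d, M m) := by
  classical
  have : Fintype {m // p m} := Fintype.ofFinite _
  have : ∀ m : {m // p m}, Fintype (omega m.1 d) := fun m => (Set.toFinite _).fintype
  exact ⟨(LinearEquiv.piCongrRight fun m => (DirectSum.linearEquivFunOnFintype ℤ (omega m.1 d)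
    fun _ => M m).symm).trans (DirectSum.linearEquivFunOnFintype ℤ {m // p m}
      fun m => ⨁ _ : omega m.1 d, M m).symm⟩

theorem finite_dvd_and (hw : 0 < w) (p : ℕ → Prop) : Finite {m : ℕ // m ∣ w ∧ p m} :=
  Set.Finite.to_subtype (s := {m | m ∣ w ∧ p m})
    ((Set.finite_le_nat w).subset fun _ h => Nat.le_of_dvd hw h.1)

/-- Extension by zero of a family indexed by some of the divisors. -/
theorem exists_extension {p : ℕ → Prop} (M : ℕ → Type) [∀ m, Zero (M m)]
    (a : (m : {m : ℕ // m ∣ w ∧ p m}) → omega m.1 d → M m.1) :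
    ∃ c : (o : (m : {m : ℕ // m ∣ w}) × omega m.1 d) → M o.1.1,
      (∀ m S, c ⟨⟨m.1, m.2.1⟩, S⟩ = a m S) ∧ ∀ o, ¬ p o.1.1 → c o = 0 := by
  classical
  exact ⟨fun o => if h : p o.1.1 then a ⟨o.1.1, o.1.2, h⟩ o.2 else 0,
    fun m S => dif_pos m.2.2, fun o h => dif_neg h⟩

theorem nonempty_HCneg_top_equiv (d : ℕ) (hw : 0 < w) : Nonempty (HCneg d w w ≃ₗ[ℤ]
    ⨁ m : {m : ℕ // m ∣ w ∧ m ≡ w [MOD 2]}, ⨁ _ : omega m.1 d, ℤ) := by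
  have := finite_dvd_and hw fun m => m ≡ w [MOD 2]
  obtain ⟨e⟩ := nonempty_directSum_equiv (d := d) (p := fun m => m ∣ w ∧ m ≡ w [MOD 2]) fun _ => ℤ
  let R := cyclicReps d hw
  let Φ : Tot ℤ (SqZero d) w →ₗ[ℤ]
      ((m : {m : ℕ // m ∣ w ∧ m ≡ w [MOD 2]}) → omega m.1 d → ℤ) :=
    LinearMap.pi fun m => LinearMap.pi fun S =>
      LinearMap.proj (R.rep ⟨⟨m.1, m.2.1⟩, S⟩) ∘ₗ evenMap d w 0 w
  obtain ⟨e'⟩ := nonempty_HCneg_equiv Φ (fun a => by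
    obtain ⟨c, hc, hc0⟩ := exists_extension (fun _ => ℤ) a
    obtain ⟨f, hf, hfr⟩ := R.exists_twist_eq (rotSign_mul_self w) c fun o => by
      by_cases h : o.1.1 ≡ w [MOD 2]
      · rw [show R.len o = o.1.1 from rfl, (rotSign_pow_eq_one_iff hw o.1.2).2 h, one_mul]
      · rw [hc0 o h, mul_zero]
    obtain ⟨z, hz, hzf⟩ := exists_evenMap_eq 0 (n := w) (by simp) hf
    refine ⟨z, hz, funext fun m => funext fun S => ?_⟩
    rw [← hc, ← hfr, ← hzf]
    rfl) fun z hz => by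
    rw [mem_boundaries_iff_evenMap_zero hz]
    constructor
    · intro h
      funext m S
      exact congrFun h _
    · intro h
      refine R.eq_zero_of_twist_eq (rotSign_mul_self w) (twist_evenMap 0 hz) fun o ho => ?_
      exact congrFun (congrFun h ⟨o.1.1, o.1.2, (rotSign_pow_eq_one_iff hw o.1.2).1 ho⟩) o.2
  exact ⟨e'.trans e⟩

theorem nonempty_HCneg_even_equiv (d : ℕ) (hw : 0 < w) {i : ℕ} (hi : 0 < i) :
    Nonempty (HCneg d w ((w : ℤ) - 2 * (i : ℤ)) ≃ₗ[ℤ]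
      ⨁ m : {m : ℕ // m ∣ w ∧ m ≡ w [MOD 2]}, ⨁ _ : omega m.1 d, ZMod (w / m.1)) := by
  obtain ⟨k, rfl⟩ := Nat.exists_eq_succ_of_ne_zero hi.ne'
  have := finite_dvd_and hw fun m => m ≡ w [MOD 2]
  obtain ⟨e⟩ := nonempty_directSum_equiv (d := d) (p := fun m => m ∣ w ∧ m ≡ w [MOD 2])
    fun m => ZMod (w / m.1)
  let R := cyclicReps d hw
  let n : ℤ := (w : ℤ) - 2 * ((k + 1 : ℕ) : ℤ)
  let Φ : Tot ℤ (SqZero d) n →ₗ[ℤ]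
      ((m : {m : ℕ // m ∣ w ∧ m ≡ w [MOD 2]}) → omega m.1 d → ZMod (w / m.1)) :=
    LinearMap.pi fun m => LinearMap.pi fun S => (Int.castAddHom (ZMod (w / m.1))).toIntLinearMap ∘ₗ
      LinearMap.proj (R.rep ⟨⟨m.1, m.2.1⟩, S⟩) ∘ₗ evenMap d w (k + 1) n
  obtain ⟨e'⟩ := nonempty_HCneg_equiv Φ (fun a => by
    obtain ⟨c, hc, hc0⟩ := exists_extension (fun m => ZMod (w / m)) a
    obtain ⟨f, hf, hfr⟩ := R.exists_twist_eq (rotSign_mul_self w)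
      -- An arbitrary integer lift of zero need not be zero, but an invariant function must vanish
      -- on the orbits of sign `-1`.
      (fun o => if c o = 0 then 0 else (ZMod.intCast_surjective (c o)).choose) fun o => by
      by_cases h : o.1.1 ≡ w [MOD 2]
      · rw [show R.len o = o.1.1 from rfl, (rotSign_pow_eq_one_iff hw o.1.2).2 h, one_mul]
      · rw [if_pos (hc0 o h), mul_zero]
    obtain ⟨z, hz, hzf⟩ := exists_evenMap_eq (k + 1) (n := n) rfl hf
    refine ⟨z, hz, funext fun m => funext fun S => ?_⟩
    change ((evenMap d w (k + 1) n z (R.rep ⟨⟨m.1, m.2.1⟩, S⟩) : ℤ) : ZMod (w / m.1)) = _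
    rw [← hc, hzf, hfr]
    split_ifs with h
    · rw [h, Int.cast_zero]
    · exact (ZMod.intCast_surjective (c ⟨⟨m.1, m.2.1⟩, S⟩)).choose_spec) fun z hz => by
    rw [mem_boundaries_iff_evenMap_succ k hw rfl hz]
    constructor
    · rintro ⟨g, hg⟩
      funext m S
      change ((evenMap d w (k + 1) n z (R.rep ⟨⟨m.1, m.2.1⟩, S⟩) : ℤ) : ZMod (w / m.1)) = 0
      rw [← hg, R.twistNorm_rep ((rotSign_pow_eq_one_iff hw m.2.1).2 m.2.2)]
      change ((((w / m.1 : ℕ) : ℤ) * _ : ℤ) : ZMod (w / m.1)) = 0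
      rw [Int.cast_mul, Int.cast_natCast, ZMod.natCast_self, zero_mul]
    · intro h
      refine R.exists_twistNorm_eq (rotSign_mul_self w) (rotSign_pow_self hw)
        (twist_evenMap (k + 1) hz) fun o ho => ?_
      exact (ZMod.intCast_zmod_eq_zero_iff_dvd _ _).1
        (congrFun (congrFun h ⟨o.1.1, o.1.2, (rotSign_pow_eq_one_iff hw o.1.2).1 ho⟩) o.2)
  exact ⟨e'.trans e⟩

theorem nonempty_HCneg_odd_equiv (d : ℕ) (hw : 0 < w) (k : ℕ) :
    Nonempty (HCneg d w ((w : ℤ) - 1 - 2 * (k : ℤ)) ≃ₗ[ℤ]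
      ⨁ m : {m : ℕ // m ∣ w ∧ ¬ m ≡ w [MOD 2]}, ⨁ _ : omega m.1 d, ZMod 2) := by
  have := finite_dvd_and hw fun m => ¬ m ≡ w [MOD 2]
  obtain ⟨e⟩ := nonempty_directSum_equiv (d := d) (p := fun m => m ∣ w ∧ ¬ m ≡ w [MOD 2])
    fun _ => ZMod 2
  let R := cyclicReps d hw
  let n : ℤ := (w : ℤ) - 1 - 2 * (k : ℤ)
  let Φ : Tot ℤ (SqZero d) n →ₗ[ℤ]
      ((m : {m : ℕ // m ∣ w ∧ ¬ m ≡ w [MOD 2]}) → omega m.1 d → ZMod 2) :=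
    LinearMap.pi fun m => LinearMap.pi fun S => (Int.castAddHom (ZMod 2)).toIntLinearMap ∘ₗ
      R.orbitSum (rotSign w) ⟨⟨m.1, m.2.1⟩, S⟩ ∘ₗ oddMap d w k n
  obtain ⟨e'⟩ := nonempty_HCneg_equiv Φ (fun a => by
    obtain ⟨c, hc, hc0⟩ := exists_extension (fun _ => ZMod 2) a
    obtain ⟨f, hf⟩ := R.exists_orbitSum_eq (rotSign w)
      -- The lift of zero is forced to be zero, so that the orbit sums vanish on the orbits of sign
      -- `1` and the norm is zero.
      (fun o => if c o = 0 then 0 else (ZMod.intCast_surjective (c o)).choose)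
    have hN := (R.twistNorm_eq_zero_iff hw (rotSign_mul_self w) (rotSign_pow_self hw) f).2
      fun o ho => by
        rw [hf, if_pos (hc0 o fun h => h ((rotSign_pow_eq_one_iff hw o.1.2).1 ho))]
    obtain ⟨z, hz, hzf⟩ := exists_oddMap_eq k (n := n) hw rfl hN
    refine ⟨z, hz, funext fun m => funext fun S => ?_⟩
    change ((R.orbitSum (rotSign w) ⟨⟨m.1, m.2.1⟩, S⟩ (oddMap d w k n z) : ℤ) : ZMod 2) = _
    rw [← hc, hzf, hf]
    split_ifs with h
    · rw [h, Int.cast_zero]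
    · exact (ZMod.intCast_surjective (c ⟨⟨m.1, m.2.1⟩, S⟩)).choose_spec) fun z hz => by
    rw [mem_boundaries_iff_oddMap k rfl hz]
    constructor
    · rintro ⟨g, hg⟩
      funext m S
      change ((R.orbitSum (rotSign w) ⟨⟨m.1, m.2.1⟩, S⟩ (oddMap d w k n z) : ℤ) : ZMod 2) = 0
      rw [← hg, R.orbitSum_sub_twist]
      change (((1 - rotSign w ^ m.1) * _ : ℤ) : ZMod 2) = 0
      rw [rotSign_pow_eq_neg_one hw m.2.1 m.2.2, ZMod.intCast_zmod_eq_zero_iff_dvd]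
      exact Dvd.intro _ (by push_cast; ring)
    · intro h
      have hN := (R.twistNorm_eq_zero_iff hw (rotSign_mul_self w) (rotSign_pow_self hw) _).1
        (twistNorm_oddMap k hz)
      refine R.exists_sub_twist_eq (rotSign_mul_self w)
        -- On orbits of sign `-1` the orbit sum is even and must be twice the initial value. On
        -- those of sign `1` it is zero because the norm vanishes, and any value would do.
        (fun o => R.orbitSum (rotSign w) o (oddMap d w k n z) / 2) fun o => ?_
      by_cases ho : o.1.1 ≡ w [MOD 2]
      · have h1 : rotSign w ^ R.len o = 1 := (rotSign_pow_eq_one_iff hw o.1.2).2 ho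
        rw [hN o h1, h1, sub_self, zero_mul]
      · have h1 : rotSign w ^ R.len o = -1 := rotSign_pow_eq_neg_one hw o.1.2 ho
        have h2 : ((2 : ℕ) : ℤ) ∣ R.orbitSum (rotSign w) o (oddMap d w k n z) :=
          (ZMod.intCast_zmod_eq_zero_iff_dvd _ _).1 (congrFun (congrFun h ⟨o.1.1, o.1.2, ho⟩) o.2)
        rw [h1, show (1 - -1 : ℤ) = ((2 : ℕ) : ℤ) by norm_num]
        exact (Int.mul_ediv_cancel' h2).symm
  exact ⟨e'.trans e⟩

end Main

end NegCyc

end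

theorem mainTheorem4 (d : ℕ) :
    -- weight zero
    (∀ n : ℤ, Even n → n ≤ 0 → Nonempty (NegCyc.HCneg d 0 n ≃ₗ[ℤ] ℤ)) ∧
    (∀ n : ℤ, ¬ (Even n ∧ n ≤ 0) → Subsingleton (NegCyc.HCneg d 0 n)) ∧
    -- positive weight
    (∀ w : ℕ, 0 < w →
      (∀ n : ℤ, (w : ℤ) < n → Subsingleton (NegCyc.HCneg d w n)) ∧
      Nonempty (NegCyc.HCneg d w w ≃ₗ[ℤ]
        ⨁ m : {m : ℕ // m ∣ w ∧ m ≡ w [MOD 2]}, ⨁ _ : NegCyc.omega m.1 d, ℤ) ∧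
      (∀ i : ℕ, Nonempty (NegCyc.HCneg d w ((w : ℤ) - 1 - 2 * (i : ℤ)) ≃ₗ[ℤ]
        ⨁ m : {m : ℕ // m ∣ w ∧ ¬ m ≡ w [MOD 2]}, ⨁ _ : NegCyc.omega m.1 d, ZMod 2)) ∧
      (∀ i : ℕ, 0 < i → Nonempty (NegCyc.HCneg d w ((w : ℤ) - 2 * (i : ℤ)) ≃ₗ[ℤ]
        ⨁ m : {m : ℕ // m ∣ w ∧ m ≡ w [MOD 2]}, ⨁ _ : NegCyc.omega m.1 d,
          ZMod (w / m.1)))) ∧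
    -- the order of the index sets
    (∀ m : ℕ, 0 < m → (NegCyc.omega m d).Finite ∧
      ((NegCyc.omega m d).ncard : ℚ) =
        1 / (m : ℚ) * ∑ i ∈ m.divisors, (ArithmeticFunction.moebius (m / i) : ℚ) * (d : ℚ) ^ i) := by
  refine ⟨fun n he hn => ?_, fun n hn => NegCyc.subsingleton_HCneg_zero hn, fun w hw =>
    ⟨fun n hn => NegCyc.subsingleton_HCneg_of_gt hn, NegCyc.nonempty_HCneg_top_equiv d hw,
      NegCyc.nonempty_HCneg_odd_equiv d hw, fun i hi => NegCyc.nonempty_HCneg_even_equiv d hw hi⟩,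
    fun m hm => ⟨Set.toFinite _, NegCyc.ncard_omega d hm⟩⟩
  obtain ⟨j, rfl⟩ := he
  exact NegCyc.nonempty_HCneg_zero_equiv (-j).toNat (by omega)
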